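/- Let $N \ge K \ge 2$ be integers, let $s>0$ be real, and write $x=(y,z)\in\mathbb R^K\times\mathbb R^{N-K}=\mathbb R^N$. Let $\mu\in\mathbb R$ satisfy $\mu\ge 0$ if $K\le 2s$, and $\mu>-\Bigl(2^s\,\Gamma(\tfrac{K+2s}{4})/\Gamma(\tfrac{K-2s}{4})\Bigr)^2$ if $K>2s$. Let $f\colon\mathbb R\to\mathbb R$ be continuous, $F(t)=\int_0^t f(r)\,\mathrm dr$, and assume (f1), where $\lesssim$ means $\le$ up to a multiplicative constant independent of $t$: - if $N<2s$, then $|f(t)|\lesssim|t|$ for $t\in[-1,1]$; - if $N=2s$, then for every $q\ge2$ and every $\alpha>\alpha_N:=N(2\pi)^N/\omega_{N-1}$, $|f(t)|\lesssim|t|+|t|^{q-1}(e^{\alpha t^2}-1)$ for $t\in\mathbb R$, where $\omega_{N-1}$ is the surface measure of the unit sphere of $\mathbb R^N$; - if $N>2s$, then $|f(t)|\lesssim|t|+|t|^{2^*-1}$ for $t\in\mathbb R$, where $2^*=\frac{2N}{N-2s}$. All functions are real-valued. Let $H^s(\mathbb R^N)$ be the space of $u\in L^2(\mathbb R^N)$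 with $\int_{\mathbb R^N}|\mathrm D^s u|^2\,\mathrm dx:=\int_{\mathbb R^N}|\xi|^{2s}|\hat u(\xi)|^2\,\mathrm d\xi<\infty$, where $\hat u$ is the unitary Fourier transform, $\hat u(\xi)=(2\pi)^{-N/2}\int_{\mathbb R^N} e^{-\mathrm i x\cdot\xi}u(x)\,\mathrm dx$ for integrable $u$. For $\rho>0$, let $\mathcal D(\rho)$ be the set of $u\in H^s(\mathbb R^N)$ such that $|\mu|\int_{\mathbb R^N}\frac{u^2}{|y|^{2s}}\,\mathrm dx<\infty$, $u(gy,z)=u(y,z)$ for every $g\in\mathcal O(K)$ and almost every $(y,z)$, and $\int_{\mathbb R^N}u^2\,\mathrm dx\le\rho$. Define $$J(u)=\frac12\int_{\mathbb R^N}\Bigl(|\mathrm D^s u|^2+\mu\frac{u^2}{|y|^{2s}}\Bigr)\mathrm dx-\int_{\mathbb R^N}F(u)\,\mathrm dx,$$ $$m(\rho)=\inf_{u\in\mathcal D(\rho)}J(u)\in[-\infty,0],\qquad \rho_*=\inf\{\rho>0 : m(\rho)<0\}\in[0,+\infty]$$ (with $\inf\emptyset=+\infty$), and let $2_\#=2+\frac{4s}{N}$.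 **Theorem.** Assume $0<\rho_*<+\infty$. If $2_\#F(t)<f(t)t$ for all $t\in\mathbb R\setminus\{0\}$, or $f(t)t<2_\#F(t)$ for all $t\in\mathbb R\setminus\{0\}$, then $J|_{\mathcal D(\rho_*)}$ has no nontrivial minimiser, i.e. there is no $u\in\mathcal D(\rho_*)\setminus\{0\}$ with $J(u)\le J(v)$ for all $v\in\mathcal D(\rho_*)$. -/

import Mathlib

open MeasureTheory FourierTransform

namespace NormSol

noncomputable section

/-- The Euclidean space `ℝ^N`. -/
abbrev RN (N : ℕ) : Type := EuclideanSpace ℝ (Fin N)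

/-- The real-valued functions in `L²(ℝ^N)` (classes modulo a.e. equality). -/
abbrev L2 (N : ℕ) : Type := Lp ℝ 2 (volume : Measure (RN N))

/-- `|y|` for `x = (y, z) ∈ ℝ^K × ℝ^{N-K}`: the Euclidean norm of the first `K` coordinates. -/
def normY (N K : ℕ) (x : RN N) : ℝ :=
  Real.sqrt (∑ i : Fin N, if i.val < K then x i ^ 2 else 0)

/-- The block-diagonal `N × N` matrix with diagonal blocks `g` and the identity matrix of
size `N - K`. -/
def blockExt (N K : ℕ) (g : Matrix (Fin K) (Fin K) ℝ) : Matrix (Fin N) (Fin N) ℝ :=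
  fun i j => if h : i.val < K ∧ j.val < K then g ⟨i.val, h.1⟩ ⟨j.val, h.2⟩
    else if i = j then 1 else 0

/-- The Fourier transform of the real-valued `u ∈ L²(ℝ^N)`, an element of `L²(ℝ^N; ℂ)`.
Mathlib normalises it as `∫ e^{-2πi x·ξ} u(x) dx` for integrable `u`, so that the Fourier symbol
of `-Δ` is `(2π|ξ|)²`. -/
def fourierL2 (N : ℕ) (u : L2 N) : Lp ℂ 2 (volume : Measure (RN N)) :=
  𝓕 (Complex.ofRealCLM.compLp u : Lp ℂ 2 (volume : Measure (RN N)))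

/-- The density `(2π|ξ|)^{2s} |û(ξ)|²`. -/
def fourierDensity (N : ℕ) (s : ℝ) (u : L2 N) (ξ : RN N) : ℝ :=
  (2 * Real.pi * ‖ξ‖) ^ (2 * s) * ‖fourierL2 N u ξ‖ ^ 2

/-- `u ∈ H^s(ℝ^N)`. -/
def MemHs (N : ℕ) (s : ℝ) (u : L2 N) : Prop :=
  Integrable (fourierDensity N s u)

/-- `∫ |D^s u|² dx` for `u ∈ H^s(ℝ^N)`. The operator `D^s` (that is `Δ^{s/2}`, `∇Δ^{(s-1)/2}` or
`(-Δ)^{s/2}`, according to whether `s` is an even integer, an odd integer or not an integer) has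
a Fourier symbol of modulus `(2π|ξ|)^s`, so this is the integral of `(2π|ξ|)^{2s} |û(ξ)|²`. -/
def DsSq (N : ℕ) (s : ℝ) (u : L2 N) : ℝ :=
  ∫ ξ, fourierDensity N s u ξ

/-- `u ∈ X^μ`: `u ∈ H^s(ℝ^N)` and `|μ| ∫ u² / |y|^{2s} dx < ∞`. -/
def MemX (N K : ℕ) (s μ : ℝ) (u : L2 N) : Prop :=
  MemHs N s u ∧ Integrable (fun x : RN N => |μ| * (u x ^ 2 / normY N K x ^ (2 * s)))

/-- `u(g̃ ·) = u` for every `g ∈ O(K)`, where `g̃ = diag(g, I_{N-K})`. -/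
def IsInvariant (N K : ℕ) (u : L2 N) : Prop :=
  ∀ g ∈ Matrix.orthogonalGroup (Fin K) ℝ,
    (fun x : RN N => u (Matrix.toEuclideanLin (blockExt N K g) x)) =ᵐ[volume] u

/-- The disc `D(ρ)`: the invariant `u ∈ X^μ` with `∫ u² dx ≤ ρ`. -/
def disc (N K : ℕ) (s μ ρ : ℝ) : Set (L2 N) :=
  {u | MemX N K s μ u ∧ IsInvariant N K u ∧ ∫ x, u x ^ 2 ≤ ρ}

/-- `F(t) = ∫_0^t f(r) dr`. -/
def primitive (f : ℝ → ℝ) (t : ℝ) : ℝ := ∫ r in (0 : ℝ)..t, f r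

/-- `J(u) = ½ ∫ (|D^s u|² + μ u² / |y|^{2s}) dx - ∫ F(u) dx`. -/
def J (N K : ℕ) (s μ : ℝ) (f : ℝ → ℝ) (u : L2 N) : ℝ :=
  1 / 2 * (DsSq N s u + ∫ x : RN N, μ * (u x ^ 2 / normY N K x ^ (2 * s)))
    - ∫ x, primitive f (u x)

/-- `m(ρ) = inf {J(u) | u ∈ D(ρ)}`, possibly `-∞`. -/
def m (N K : ℕ) (s μ : ℝ) (f : ℝ → ℝ) (ρ : ℝ) : EReal :=
  ⨅ u ∈ disc N K s μ ρ, (J N K s μ f u : EReal)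

/-- `ρ_* = inf {ρ > 0 | m(ρ) < 0}`, equal to `+∞` if there is no such `ρ`. -/
def rhoStar (N K : ℕ) (s μ : ℝ) (f : ℝ → ℝ) : EReal :=
  ⨅ (ρ : ℝ) (_ : 0 < ρ ∧ m N K s μ f ρ < 0), (ρ : EReal)

/-- The mass-critical exponent `2_# = 2 + 4s/N`. -/
def massCritical (N : ℕ) (s : ℝ) : ℝ := 2 + 4 * s / N

/-- `α_N = N (2π)^N / ω_{N-1}`, with `ω_{N-1}` the surface measure of the unit sphere of `ℝ^N`. -/
def alphaN (N : ℕ) : ℝ :=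
  N * (2 * Real.pi) ^ N / (volume : Measure (RN N)).toSphere.real Set.univ

/-- The growth assumption on the continuous nonlinearity `f`. -/
structure Growth (N : ℕ) (s : ℝ) (f : ℝ → ℝ) : Prop where
  continuous : Continuous f
  subcritical : (N : ℝ) < 2 * s → ∃ C : ℝ, ∀ t ∈ Set.Icc (-1 : ℝ) 1, |f t| ≤ C * |t|
  exponential : (N : ℝ) = 2 * s → ∀ q : ℝ, 2 ≤ q → ∀ α : ℝ, alphaN N < α →
    ∃ C : ℝ, ∀ t : ℝ, |f t| ≤ C * (|t| + |t| ^ (q - 1) * (Real.exp (α * t ^ 2) - 1))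
  sobolev : 2 * s < (N : ℝ) →
    ∃ C : ℝ, ∀ t : ℝ, |f t| ≤ C * (|t| + |t| ^ (2 * (N : ℝ) / (N - 2 * s) - 1))

/-- The admissible range of `μ`: `μ ≥ 0` if `K ≤ 2s`, and
`μ > -(2^s Γ((K+2s)/4) / Γ((K-2s)/4))²` if `K > 2s`. -/
def AdmissibleMu (K : ℕ) (s μ : ℝ) : Prop :=
  ((K : ℝ) ≤ 2 * s → 0 ≤ μ) ∧
  (2 * s < (K : ℝ) →
    -((2 : ℝ) ^ s * (Real.Gamma ((K + 2 * s) / 4) / Real.Gamma ((K - 2 * s) / 4))) ^ 2 < μ)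

end

end NormSol

namespace NormSol

open Set
open scoped ContDiff SchwartzMap

/-! With c = a^(2/N), the dilation v = a u(c ·) keeps the mass of u, multiplies the quadratic part
of J by a^(4s/N), and turns ∫ F(u) into a^(-2) ∫ F(a u). Since 2_# - 2 = 4s/N, the inequality F(a t)
> a^(2_#) F(t) for t ≠ 0 gives J(v) < a^(4s/N) J(u) when u ≠ 0 (`exists_mem_disc_J_lt`). The
derivative of a ↦ a^(-2_#) F(a t) has the sign of f(r) r - 2_# F(r) at r = a t, so the first
alternative yields that inequality for a > 1 and the second for a < 1.

A minimiser u satisfies J(u) ≤ J(0) = 0. Under the first alternative, a = 2 gives J(v) < J(u). Under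
the second, J(u) = 0 is excluded by a = 1/2, while J(u) < 0 would persist for a u with a < 1 close
to 1, that is, at a mass below ρ_* (`exists_rescale_J_neg`).

The strict comparison of integrals needs F(u) integrable for u ∈ H^s (`integrable_primitive_comp`);
this is the bulk of the file. The embeddings come from the Fourier side: at each level t,
frequencies are cut at a radius depending on t so that the low ones contribute at most t/2
uniformly, and Chebyshev is applied to the high ones (`measure_le_abs_le`). -/

/-! ### The L² Fourier transform and its integral formula. -/

/-- Locally integrable functions with the same integral against every Schwartz function coincide. -/
theorem ae_eq_of_integral_schwartz_smul_eq {N : ℕ} {g h : RN N → ℂ}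
    (hg : LocallyIntegrable g) (hh : LocallyIntegrable h)
    (H : ∀ φ : 𝓢(RN N, ℂ), ∫ x, φ x • g x = ∫ x, φ x • h x) : g =ᵐ[volume] h := by
  refine ae_eq_of_integral_contDiff_smul_eq hg hh fun ψ ψ_smooth ψ_cpt => ?_
  have h₁ : HasCompactSupport (Complex.ofRealCLM ∘ ψ) := ψ_cpt.comp_left rfl
  have h₂ : ContDiff ℝ ∞ (Complex.ofRealCLM ∘ ψ) := by fun_prop
  simpa using H (h₁.toSchwartzMap h₂)

theorem locallyIntegrable_Lp {N : ℕ} (g : Lp ℂ 2 (volume : Measure (RN N))) :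
    LocallyIntegrable g :=
  (Lp.memLp g).locallyIntegrable (by norm_num)

/-- Compatibility of the L² and distributional transforms moves the transform onto the test
function, where the integral formula is available. -/
theorem integral_schwartz_smul_fourier {N : ℕ} (g : Lp ℂ 2 (volume : Measure (RN N)))
    (φ : 𝓢(RN N, ℂ)) : ∫ x, φ x • (𝓕 g : Lp ℂ 2 (volume : Measure (RN N))) x
      = ∫ x, (𝓕 φ) x • g x := by
  have := congrArg (fun T => T φ) (Lp.fourier_toTemperedDistribution_eq g)
  simpa [TemperedDistribution.fourier_apply] using this.symm

theorem integral_schwartz_smul_fourierInv {N : ℕ} (g : Lp ℂ 2 (volume : Measure (RN N)))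
    (φ : 𝓢(RN N, ℂ)) : ∫ x, φ x • (𝓕⁻ g : Lp ℂ 2 (volume : Measure (RN N))) x
      = ∫ x, (𝓕⁻ φ) x • g x := by
  have := congrArg (fun T => T φ) (Lp.fourierInv_toTemperedDistribution_eq g)
  simpa [TemperedDistribution.fourierInv_apply] using this.symm

theorem norm_fourierInv_le {N : ℕ} (g : RN N → ℂ) (x : RN N) : ‖𝓕⁻ g x‖ ≤ ∫ ξ, ‖g ξ‖ := by
  rw [Real.fourierInv_eq]
  refine (norm_integral_le_integral_norm _).trans (le_of_eq ?_)
  simp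

theorem continuous_fourierInv_of_integrable {N : ℕ} {g : RN N → ℂ} (hg : Integrable g) :
    Continuous (𝓕⁻ g) := by
  have : 𝓕⁻ g = fun x => 𝓕 g (-x) := by
    ext x; exact Real.fourierInv_eq_fourier_neg g x
  rw [this]
  have h1 : Continuous (𝓕 g) :=
    VectorFourier.fourierIntegral_continuous Real.continuous_fourierChar
      (by exact continuous_inner) hg
  exact h1.comp continuous_neg

/-- On `L¹ ∩ L²`, the `L²` inverse Fourier transform is given by the integral formula. -/
theorem Lp_fourierInv_ae_eq {N : ℕ} (g : Lp ℂ 2 (volume : Measure (RN N)))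
    (hg : Integrable g) :
    (𝓕⁻ g : Lp ℂ 2 (volume : Measure (RN N))) =ᵐ[volume] 𝓕⁻ (g : RN N → ℂ) := by
  refine ae_eq_of_integral_schwartz_smul_eq (locallyIntegrable_Lp _)
    (continuous_fourierInv_of_integrable hg).locallyIntegrable fun φ => ?_
  rw [integral_schwartz_smul_fourierInv]
  -- Fubini for the Fourier kernel, applied to the reflection of g because the inverse transform is
  -- the direct one precomposed with x ↦ -x.
  have key : ∫ x, 𝓕 (φ : RN N → ℂ) x • g (-x) = ∫ x, φ x • 𝓕 (fun y => g (-y)) x := by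
    have := VectorFourier.integral_fourierIntegral_smul_eq_flip (L := innerₗ (RN N))
      (μ := volume) (ν := volume) Real.continuous_fourierChar continuous_inner
      φ.integrable hg.comp_neg
    rwa [flip_innerₗ] at this
  calc ∫ x, (𝓕⁻ φ) x • g x = ∫ x, 𝓕 (φ : RN N → ℂ) x • g (-x) := by
        rw [← integral_neg_eq_self]
        congr 1; ext x
        rw [SchwartzMap.fourierInv_coe, Real.fourierInv_eq_fourier_neg, neg_neg]
    _ = ∫ x, φ x • 𝓕 (fun y => g (-y)) x := key
    _ = _ := by
        congr 1; ext x
        rw [Real.fourierInv_eq_fourier_comp_neg]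

theorem ae_norm_Lp_fourierInv_le {N : ℕ} (g : Lp ℂ 2 (volume : Measure (RN N)))
    (hg : Integrable g) :
    ∀ᵐ x, ‖(𝓕⁻ g : Lp ℂ 2 (volume : Measure (RN N))) x‖ ≤ ∫ ξ, ‖g ξ‖ := by
  filter_upwards [Lp_fourierInv_ae_eq g hg] with x hx
  rw [hx]
  exact norm_fourierInv_le _ _

theorem fourierInv_fourierL2 {N : ℕ} (u : L2 N) :
    𝓕⁻ (fourierL2 N u) = (Complex.ofRealCLM.compLp u : Lp ℂ 2 (volume : Measure (RN N))) := by
  simp [fourierL2]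

theorem ae_abs_eq_norm_fourierInv {N : ℕ} (u : L2 N) :
    ∀ᵐ x, |u x| = ‖(𝓕⁻ (fourierL2 N u) : Lp ℂ 2 (volume : Measure (RN N))) x‖ := by
  rw [fourierInv_fourierL2]
  filter_upwards [Complex.ofRealCLM.coeFn_compLp u] with x hx
  rw [hx]; simp

theorem ae_abs_le_of_integrable_fourier {N : ℕ} (u : L2 N) (h : Integrable (fourierL2 N u)) :
    ∀ᵐ x, |u x| ≤ ∫ ξ, ‖fourierL2 N u ξ‖ := by
  filter_upwards [ae_norm_Lp_fourierInv_le _ h, ae_abs_eq_norm_fourierInv u] with x h1 h2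
  rwa [h2]

/-! ### Frequency splitting and weighted bounds on û. -/

/-- Superlevel sets of `u` are controlled by the frequencies outside `S`, as soon as the frequencies
in `S` contribute at most `t / 2` in the uniform norm. -/
theorem measure_le_abs_le {N : ℕ} (u : L2 N) {S : Set (RN N)} (hS : MeasurableSet S)
    (hint : IntegrableOn (fourierL2 N u) S) {t : ℝ} (ht : 0 < t)
    (hSt : ∫ ξ in S, ‖fourierL2 N u ξ‖ ≤ t / 2) :
    volume {x | t ≤ |u x|} ≤
      ENNReal.ofReal (4 / t ^ 2) * ∫⁻ ξ in Sᶜ, ‖fourierL2 N u ξ‖ₑ ^ 2 := by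
  set g := fourierL2 N u with hgdef
  have hl : MemLp (S.indicator g) 2 := (Lp.memLp g).indicator hS
  have hh : MemLp (Sᶜ.indicator g) 2 := (Lp.memLp g).indicator hS.compl
  -- The part gl contributes at most t/2 almost everywhere, so |u| ≥ t forces the inverse transform
  -- w of gh to have modulus at least t/2. Chebyshev at t/2 gives the factor 4/t², and Plancherel
  -- evaluates the norm of w.
  set gl : Lp ℂ 2 (volume : Measure (RN N)) := hl.toLp _
  set gh : Lp ℂ 2 (volume : Measure (RN N)) := hh.toLp _
  have hsum : g = gl + gh := by
    apply Lp.ext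
    filter_upwards [Lp.coeFn_add gl gh, hl.coeFn_toLp, hh.coeFn_toLp] with x h1 h2 h3
    rw [h1, Pi.add_apply, h2, h3, ← Pi.add_apply, Set.indicator_self_add_compl]
  have hgl : Integrable gl :=
    (integrable_congr hl.coeFn_toLp).2 ((integrable_indicator_iff hS).2 hint)
  have hglt : ∫ ξ, ‖gl ξ‖ ≤ t / 2 := by
    refine le_trans (le_of_eq ?_) hSt
    rw [← integral_indicator hS]
    refine integral_congr_ae ?_
    filter_upwards [hl.coeFn_toLp] with x h2
    rw [h2, norm_indicator_eq_indicator_norm]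
  set w : Lp ℂ 2 (volume : Measure (RN N)) := 𝓕⁻ gh
  have hw : eLpNorm w 2 volume ^ 2 = ∫⁻ ξ in Sᶜ, ‖g ξ‖ₑ ^ 2 := by
    have h1 : eLpNorm w 2 volume = eLpNorm gh 2 volume := by
      rw [← Lp.enorm_def, ← Lp.enorm_def]
      have : ‖w‖ = ‖gh‖ := by
        rw [← Lp.norm_fourier_eq w]; simp [w]
      exact (enorm_eq_iff_norm_eq).2 this
    rw [h1, eLpNorm_congr_ae hh.coeFn_toLp, ← lintegral_indicator hS.compl]
    have := eLpNorm_nnreal_pow_eq_lintegral (μ := volume) (f := Sᶜ.indicator g) (p := 2) (by norm_num)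
    simp only [NNReal.coe_ofNat, ENNReal.coe_ofNat, ENNReal.rpow_ofNat] at this
    rw [this]
    refine lintegral_congr fun x => ?_
    by_cases hx : x ∈ Sᶜ
    · simp [Set.indicator_of_mem hx]
    · simp [Set.indicator_of_notMem hx]
  have hle : volume {x | t ≤ |u x|} ≤ volume {x | ENNReal.ofReal (t / 2) ≤ ‖w x‖ₑ} := by
    refine measure_mono_ae ?_
    have hadd : (𝓕⁻ g : Lp ℂ 2 (volume : Measure (RN N))) = 𝓕⁻ gl + w := by
      rw [hsum]; exact FourierTransform.fourierInv_add gl gh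
    filter_upwards [ae_norm_Lp_fourierInv_le gl hgl, ae_abs_eq_norm_fourierInv u,
      Lp.coeFn_add (𝓕⁻ gl : Lp ℂ 2 (volume : Measure (RN N))) w] with x h1 h2 h3 (h4 : t ≤ |u x|)
    change ENNReal.ofReal (t / 2) ≤ ‖w x‖ₑ
    rw [h2, ← hgdef, hadd, h3, Pi.add_apply] at h4
    rw [← ofReal_norm]
    refine ENNReal.ofReal_le_ofReal ?_
    have := norm_add_le ((𝓕⁻ gl : Lp ℂ 2 (volume : Measure (RN N))) x) (w x)
    linarith
  refine hle.trans ?_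
  have hmar := meas_ge_le_mul_pow_eLpNorm_enorm (volume : Measure (RN N)) (p := 2) (by norm_num)
    (by norm_num) (Lp.aestronglyMeasurable w) (ε := ENNReal.ofReal (t / 2))
    (by simpa using ht) (by simp)
  refine hmar.trans (le_of_eq ?_)
  simp only [ENNReal.toReal_ofNat, ENNReal.rpow_ofNat]
  rw [hw, ← ENNReal.ofReal_inv_of_pos (by positivity), ← ENNReal.ofReal_pow (by positivity)]
  congr 2
  field_simp; norm_num

/-- The weight `(2π|ξ|)^{2s}` of the homogeneous Sobolev seminorm. -/
noncomputable def weight (N : ℕ) (s : ℝ) (ξ : RN N) : ℝ := (2 * Real.pi * ‖ξ‖) ^ (2 * s)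

theorem weight_nonneg {N : ℕ} {s : ℝ} (ξ : RN N) : 0 ≤ weight N s ξ := by
  unfold weight; positivity

theorem weight_pos {N : ℕ} {s : ℝ} {ξ : RN N} (h : ξ ≠ 0) : 0 < weight N s ξ := by
  have := norm_pos_iff.2 h
  have := Real.pi_pos
  unfold weight; positivity

theorem fourierDensity_eq {N : ℕ} {s : ℝ} (u : L2 N) (ξ : RN N) :
    fourierDensity N s u ξ = weight N s ξ * ‖fourierL2 N u ξ‖ ^ 2 := rfl

theorem fourierDensity_nonneg {N : ℕ} {s : ℝ} (u : L2 N) (ξ : RN N) :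
    0 ≤ fourierDensity N s u ξ :=
  mul_nonneg (weight_nonneg ξ) (sq_nonneg _)

/-- Young's inequality form of the Cauchy–Schwarz bound for `û` on a set of frequencies. -/
theorem integrableOn_fourier_and_le {N : ℕ} (hN : 0 < N) {s : ℝ} {u : L2 N} (hu : MemHs N s u)
    {S : Set (RN N)} (hw : IntegrableOn (fun ξ => (weight N s ξ)⁻¹) S) {δ : ℝ} (hδ : 0 < δ) :
    IntegrableOn (fourierL2 N u) S ∧ ∫ ξ in S, ‖fourierL2 N u ξ‖ ≤
      δ / 2 * (∫ ξ in S, (weight N s ξ)⁻¹) +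
        1 / (2 * δ) * ∫ ξ in S, fourierDensity N s u ξ := by
  have : Nonempty (Fin N) := ⟨⟨0, hN⟩⟩
  have h0 : ∀ᵐ ξ ∂(volume.restrict S : Measure (RN N)), ξ ≠ 0 := by
    refine ae_restrict_of_ae ?_
    simp [ae_iff]
  have hb : ∀ᵐ ξ ∂(volume.restrict S : Measure (RN N)), ‖fourierL2 N u ξ‖ ≤
      δ / 2 * (weight N s ξ)⁻¹ + 1 / (2 * δ) * fourierDensity N s u ξ := by
    filter_upwards [h0] with ξ hξ
    have hp : 0 < weight N s ξ := weight_pos hξ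
    rw [fourierDensity_eq]
    set a := ‖fourierL2 N u ξ‖
    set w := weight N s ξ
    -- The defect in Young's inequality is a perfect square; δ stays free so that it can be tuned to
    -- the level t.
    have : δ / 2 * w⁻¹ + 1 / (2 * δ) * (w * a ^ 2) - a = (δ - w * a) ^ 2 / (2 * δ * w) := by
      field_simp; ring
    have h2 : 0 ≤ (δ - w * a) ^ 2 / (2 * δ * w) := by positivity
    linarith
  have hu' : IntegrableOn (fourierDensity N s u) S := hu.integrableOn
  have hi : IntegrableOn (fun ξ => δ / 2 * (weight N s ξ)⁻¹
      + 1 / (2 * δ) * fourierDensity N s u ξ) S := (hw.const_mul _).add (hu'.const_mul _)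
  have hint : IntegrableOn (fourierL2 N u) S :=
    Integrable.mono' hi (Lp.aestronglyMeasurable _).restrict hb
  refine ⟨hint, ?_⟩
  rw [← integral_const_mul, ← integral_const_mul, ← integral_add (hw.const_mul _)
    (hu'.const_mul _)]
  exact integral_mono_ae hint.norm hi hb

theorem integrableOn_fourier_of_measure_ne_top {N : ℕ} (u : L2 N) {S : Set (RN N)}
    (hS : volume S ≠ ⊤) : IntegrableOn (fourierL2 N u) S := by
  have : Fact (volume S < ⊤) := ⟨hS.lt_top⟩
  exact ((Lp.memLp (fourierL2 N u)).restrict S).integrable (by norm_num)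

/-- Polar coordinates for the reciprocal of the weight. -/
theorem integral_inv_weight {N : ℕ} (hN : 0 < N) (s : ℝ) :
    ∃ C : ℝ, 0 < C ∧ ∀ I : Set ℝ, MeasurableSet I → I ⊆ Ioi 0 →
      IntegrableOn (fun y : ℝ => y ^ ((N : ℝ) - 1 - 2 * s)) I →
      IntegrableOn (fun ξ => (weight N s ξ)⁻¹) {ξ | ‖ξ‖ ∈ I} ∧
      ∫ ξ in {ξ | ‖ξ‖ ∈ I}, (weight N s ξ)⁻¹ = C * ∫ y in I, y ^ ((N : ℝ) - 1 - 2 * s) := by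
  have : Nonempty (Fin N) := ⟨⟨0, hN⟩⟩
  have : Nontrivial (RN N) := inferInstance
  have hpi := Real.pi_pos
  set V := (volume : Measure (RN N)).real (Metric.ball 0 1)
  have hV : 0 < V := by
    refine ENNReal.toReal_pos ?_ measure_ball_lt_top.ne
    exact (Metric.measure_ball_pos _ _ one_pos).ne'
  refine ⟨N * V * ((2 * Real.pi) ^ (2 * s))⁻¹, by positivity, fun I hI hI0 hint => ?_⟩
  set h : ℝ → ℝ := I.indicator fun y => ((2 * Real.pi * y) ^ (2 * s))⁻¹
  have hfin : Module.finrank ℝ (RN N) = N := by simp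
  have hpt : ∀ y : ℝ, 0 < y → y ^ (N - 1) • h y
      = ((2 * Real.pi) ^ (2 * s))⁻¹ * I.indicator (fun y => y ^ ((N : ℝ) - 1 - 2 * s)) y := by
    intro y hy
    by_cases hyI : y ∈ I
    · simp only [h, indicator_of_mem hyI, smul_eq_mul]
      rw [Real.mul_rpow (by positivity) hy.le, mul_inv, Real.rpow_sub hy]
      have : y ^ ((N : ℝ) - 1) = y ^ (N - 1) := by
        rw [← Real.rpow_natCast, Nat.cast_sub hN, Nat.cast_one]
      rw [this]; ring
    · simp [h, indicator_of_notMem hyI]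
  have heq : ({ξ : RN N | ‖ξ‖ ∈ I}).indicator (fun ξ => (weight N s ξ)⁻¹) = fun ξ => h ‖ξ‖ := by
    ext ξ
    by_cases hξ : ‖ξ‖ ∈ I
    · simp [h, weight, indicator, hξ]
    · simp [h, indicator, hξ]
  have hmeas : MeasurableSet {ξ : RN N | ‖ξ‖ ∈ I} := measurable_norm hI
  have hindint : Integrable (I.indicator fun y : ℝ => y ^ ((N : ℝ) - 1 - 2 * s)) :=
    (integrable_indicator_iff hI).2 hint
  constructor
  · rw [← integrable_indicator_iff hmeas, heq, integrable_fun_norm_addHaar, hfin]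
    refine IntegrableOn.congr_fun (hindint.const_mul _).integrableOn
      (fun y hy => (hpt y hy).symm) measurableSet_Ioi
  · rw [← integral_indicator hmeas, heq, integral_fun_norm_addHaar, hfin,
      setIntegral_congr_fun measurableSet_Ioi (fun y hy => hpt y hy), integral_const_mul,
      setIntegral_indicator hI, inter_eq_right.2 hI0]
    simp only [nsmul_eq_mul, smul_eq_mul]
    ring

theorem integrable_sq {N : ℕ} (u : L2 N) : Integrable fun x => u x ^ 2 :=
  (Lp.memLp u).integrable_sq

/-! ### Embeddings of H^s for N ≠ 2s. -/

/-- For `2s > N`, functions of `H^s` are essentially bounded. -/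
theorem exists_ae_abs_le {N : ℕ} (hN : 0 < N) {s : ℝ} (hNs : (N : ℝ) < 2 * s) {u : L2 N}
    (hu : MemHs N s u) : ∃ M : ℝ, ∀ᵐ x, |u x| ≤ M := by
  obtain ⟨C, hC, hrad⟩ := integral_inv_weight hN s
  have hI : IntegrableOn (fun y : ℝ => y ^ ((N : ℝ) - 1 - 2 * s)) (Ici 1) := by
    rw [integrableOn_Ici_iff_integrableOn_Ioi]
    exact integrableOn_Ioi_rpow_of_lt (by linarith) one_pos
  have h1 := (integrableOn_fourier_and_le hN hu
    (hrad _ measurableSet_Ici (Ici_subset_Ioi.2 one_pos) hI).1 one_pos).1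
  have h2 : IntegrableOn (fourierL2 N u) (Metric.ball 0 1) :=
    integrableOn_fourier_of_measure_ne_top u measure_ball_lt_top.ne
  refine ⟨_, ae_abs_le_of_integrable_fourier u ?_⟩
  rw [← integrableOn_univ]
  refine (h2.union h1).mono_set fun ξ _ => ?_
  by_cases h : ‖ξ‖ < 1
  · left; simpa using h
  · right; simpa using h

/-- The Sobolev embedding `H^s ⊂ L^{2N/(N-2s)}` for `2s < N`. -/
theorem integrable_abs_rpow_sobolev {N : ℕ} (hN : 0 < N) {s : ℝ} (hs : 0 < s)
    (hNs : 2 * s < (N : ℝ)) {u : L2 N} (hu : MemHs N s u) :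
    Integrable fun x => |u x| ^ (2 * (N : ℝ) / (N - 2 * s)) := by
  have hd : 0 < (N : ℝ) - 2 * s := by linarith
  have hNr : (0 : ℝ) < N := by exact_mod_cast hN
  set d := (N : ℝ) - 2 * s with hd'
  set p := 2 * (N : ℝ) / d with hp
  have hp2 : p - 2 = 4 * s / d := by rw [hp]; field_simp; rw [hd']; ring
  have hp2' : 0 < p - 2 := by rw [hp2]; positivity
  obtain ⟨C, hC, hrad⟩ := integral_inv_weight hN s
  set E := DsSq N s u with hE
  have hE0 : 0 ≤ E := integral_nonneg fun ξ => fourierDensity_nonneg u ξ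
  -- With cutoff radius κ t^(2/d) and δ = 2(E + 1)/t, this κ makes the two Young terms t/8 and at
  -- most t/4. Using E + 1 rather than E avoids dividing by zero.
  set κ := (d / (8 * C * (E + 1))) ^ d⁻¹ with hκ
  have hκ0 : 0 < κ := by positivity
  have hκd : κ ^ d = d / (8 * C * (E + 1)) := by
    rw [hκ, ← Real.rpow_mul (by positivity), inv_mul_cancel₀ hd.ne', Real.rpow_one]
  set S : ℝ → Set (RN N) := fun t => {ξ | ‖ξ‖ < κ * t ^ (2 / d)} with hS
  have hmeasS : ∀ t, MeasurableSet (S t) := fun t => measurableSet_lt measurable_norm measurable_const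
  have hlow : ∀ t : ℝ, 0 < t → IntegrableOn (fourierL2 N u) (S t) ∧
      ∫ ξ in S t, ‖fourierL2 N u ξ‖ ≤ t / 2 := by
    intro t ht
    set A := κ * t ^ (2 / d) with hA
    have hA0 : 0 < A := by positivity
    have hAd : A ^ d = d / (8 * C * (E + 1)) * t ^ 2 := by
      rw [hA, Real.mul_rpow hκ0.le (by positivity), hκd, ← Real.rpow_mul ht.le,
        div_mul_cancel₀ _ hd.ne', Real.rpow_two]
    have hI : IntegrableOn (fun y : ℝ => y ^ ((N : ℝ) - 1 - 2 * s)) (Ioo 0 A) := by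
      have := (intervalIntegral.intervalIntegrable_rpow' (a := 0) (b := A)
        (r := (N : ℝ) - 1 - 2 * s) (by linarith)).1
      exact this.mono_set Ioo_subset_Ioc_self
    obtain ⟨h1, h2⟩ := hrad _ measurableSet_Ioo (fun y hy => hy.1) hI
    have hval : ∫ y in Ioo 0 A, y ^ ((N : ℝ) - 1 - 2 * s) = A ^ d / d := by
      rw [← integral_Ioc_eq_integral_Ioo, ← intervalIntegral.integral_of_le hA0.le,
        integral_rpow (Or.inl (by linarith)),
        show (N : ℝ) - 1 - 2 * s + 1 = d by rw [hd']; ring, Real.zero_rpow hd.ne', sub_zero]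
    have hset : (S t : Set (RN N)) =ᵐ[volume] {ξ | ‖ξ‖ ∈ Ioo 0 A} := by
      have : Nonempty (Fin N) := ⟨⟨0, hN⟩⟩
      have : ∀ᵐ ξ : RN N, ξ ≠ 0 := by simp [ae_iff]
      filter_upwards [this] with ξ hξ
      have : 0 < ‖ξ‖ := norm_pos_iff.2 hξ
      apply propext
      change ‖ξ‖ < A ↔ (0 < ‖ξ‖ ∧ ‖ξ‖ < A)
      tauto
    obtain ⟨h3, h4⟩ := integrableOn_fourier_and_le hN hu h1 (δ := 2 * (E + 1) / t) (by positivity)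
    refine ⟨h3.congr_set_ae hset, ?_⟩
    rw [setIntegral_congr_set hset]
    refine h4.trans ?_
    rw [h2, hval, hAd]
    have h5 : ∫ ξ in {ξ : RN N | ‖ξ‖ ∈ Ioo 0 A}, fourierDensity N s u ξ ≤ E :=
      setIntegral_le_integral hu (Filter.Eventually.of_forall fun ξ => fourierDensity_nonneg u ξ)
    have h6 : 1 / (2 * (2 * (E + 1) / t)) *
        ∫ ξ in {ξ : RN N | ‖ξ‖ ∈ Ioo 0 A}, fourierDensity N s u ξ
        ≤ 1 / (2 * (2 * (E + 1) / t)) * (E + 1) := by gcongr; linarith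
    have h7 : 1 / (2 * (2 * (E + 1) / t)) * (E + 1) = t / 4 := by field_simp; norm_num
    have h8 : 2 * (E + 1) / t / 2 * (C * (d / (8 * C * (E + 1)) * t ^ 2 / d)) = t / 8 := by
      field_simp
    rw [h8]; linarith
  have hmeas : AEStronglyMeasurable (fun x => |u x| ^ p) volume := by
    have : AEMeasurable (fun x => |u x| ^ p) volume :=
      ((Lp.aestronglyMeasurable u).aemeasurable.abs).pow_const p
    exact this.aestronglyMeasurable
  have hp0 : 0 < p := by linarith
  have hnn : 0 ≤ᵐ[volume] fun x => |u x| := Filter.Eventually.of_forall fun x => abs_nonneg _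
  refine (lintegral_ofReal_ne_top_iff_integrable hmeas
    (Filter.Eventually.of_forall fun x => by positivity)).1 ?_
  rw [lintegral_rpow_eq_lintegral_meas_le_mul volume hnn
    (Lp.aestronglyMeasurable u).aemeasurable.abs hp0]
  refine ENNReal.mul_ne_top ENNReal.ofReal_ne_top ?_
  set G : RN N → ENNReal := fun ξ => ‖fourierL2 N u ξ‖ₑ ^ 2 with hG
  have hGm : Measurable G := (Lp.stronglyMeasurable (fourierL2 N u)).measurable.enorm.pow_const 2
  set Q : Set (ℝ × RN N) := {q | κ * q.1 ^ (2 / d) ≤ ‖q.2‖} with hQ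
  have hQm : MeasurableSet Q :=
    measurableSet_le ((measurable_fst.pow_const _).const_mul _) measurable_snd.norm
  have hbound : ∫⁻ t in Ioi (0 : ℝ), volume {x | t ≤ |u x|} * ENNReal.ofReal (t ^ (p - 1)) ≤
      ∫⁻ t in Ioi (0 : ℝ), ∫⁻ ξ, Q.indicator
        (fun q => ENNReal.ofReal (4 * q.1 ^ (p - 3)) * G q.2) (t, ξ) := by
    refine setLIntegral_mono' measurableSet_Ioi fun t (ht : 0 < t) => ?_
    obtain ⟨h1, h2⟩ := hlow t ht
    have h3 := measure_le_abs_le u (hmeasS t) h1 ht h2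
    have h4 : ∫⁻ ξ, Q.indicator (fun q => ENNReal.ofReal (4 * q.1 ^ (p - 3)) * G q.2) (t, ξ)
        = ENNReal.ofReal (4 * t ^ (p - 3)) * ∫⁻ ξ in (S t)ᶜ, G ξ := by
      rw [← lintegral_const_mul _ hGm, ← lintegral_indicator (hmeasS t).compl]
      refine lintegral_congr fun ξ => ?_
      by_cases hξ : ‖ξ‖ < κ * t ^ (2 / d)
      · rw [indicator_of_notMem (by simpa [hQ] using hξ),
          indicator_of_notMem (by simpa [hS] using hξ)]
      · rw [indicator_of_mem (by simpa [hQ] using hξ),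
          indicator_of_mem (by simpa [hS] using hξ)]
    rw [h4]
    calc volume {x | t ≤ |u x|} * ENNReal.ofReal (t ^ (p - 1))
        ≤ ENNReal.ofReal (4 / t ^ 2) * (∫⁻ ξ in (S t)ᶜ, G ξ) * ENNReal.ofReal (t ^ (p - 1)) := by
          gcongr
      _ = ENNReal.ofReal (4 * t ^ (p - 3)) * ∫⁻ ξ in (S t)ᶜ, G ξ := by
          rw [mul_right_comm, ← ENNReal.ofReal_mul (by positivity)]
          congr 2
          rw [show p - 3 = p - 1 - 2 by ring, Real.rpow_sub ht (p - 1) 2, Real.rpow_two]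
          ring
  refine ne_top_of_le_ne_top ?_ hbound
  -- Tonelli: for fixed ξ, the positive levels t whose cutoff lies at or below |ξ| form (0, T], and
  -- T^(p-2) is a multiple of |ξ|^(2s). The remaining integral is a multiple of the H^s seminorm.
  rw [lintegral_lintegral_swap]
  swap
  · refine Measurable.aemeasurable ?_
    refine Measurable.indicator ?_ hQm
    exact (((measurable_fst.pow_const _).const_mul _).ennreal_ofReal).mul
      (hGm.comp measurable_snd)
  have hinner : ∀ ξ : RN N, ∫⁻ t in Ioi (0 : ℝ), Q.indicator
        (fun q => ENNReal.ofReal (4 * q.1 ^ (p - 3)) * G q.2) (t, ξ)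
      ≤ ENNReal.ofReal (4 / (p - 2) * (κ⁻¹ ^ (2 * s)) * ((2 * Real.pi) ^ (2 * s))⁻¹ *
          fourierDensity N s u ξ) := by
    intro ξ
    set T := (κ⁻¹ * ‖ξ‖) ^ (d / 2) with hT
    have hT0 : 0 ≤ T := by positivity
    have h1 : ∀ t ∈ Ioi (0 : ℝ), Q.indicator
        (fun q => ENNReal.ofReal (4 * q.1 ^ (p - 3)) * G q.2) (t, ξ)
        ≤ (Ioc 0 T).indicator (fun t => ENNReal.ofReal (4 * t ^ (p - 3))) t * G ξ := by
      intro t (ht : 0 < t)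
      by_cases hq : (t, ξ) ∈ Q
      · have htT : t ≤ T := by
          have h2 : t ^ (2 / d) ≤ κ⁻¹ * ‖ξ‖ := by
            rw [inv_mul_eq_div, le_div_iff₀ hκ0, mul_comm]; exact hq
          have h3 := Real.rpow_le_rpow (by positivity) h2 (z := d / 2) (by positivity)
          rwa [← Real.rpow_mul ht.le, show 2 / d * (d / 2) = 1 by field_simp,
            Real.rpow_one] at h3
        rw [indicator_of_mem hq, indicator_of_mem (show t ∈ Ioc 0 T from ⟨ht, htT⟩)]
      · rw [indicator_of_notMem hq]; exact zero_le
    refine (setLIntegral_mono' measurableSet_Ioi h1).trans ?_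
    have hmt : Measurable fun t : ℝ => ENNReal.ofReal (4 * t ^ (p - 3)) :=
      ((measurable_id.pow_const _).const_mul _).ennreal_ofReal
    rw [lintegral_mul_const _ (hmt.indicator measurableSet_Ioc), lintegral_indicator
      measurableSet_Ioc, Measure.restrict_restrict measurableSet_Ioc,
      inter_eq_left.2 Ioc_subset_Ioi_self]
    have hint : IntervalIntegrable (fun t : ℝ => 4 * t ^ (p - 3)) volume 0 T :=
      (intervalIntegral.intervalIntegrable_rpow' (by linarith)).const_mul 4
    rw [← ofReal_integral_eq_lintegral_ofReal hint.1]
    swap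
    · filter_upwards [self_mem_ae_restrict (measurableSet_Ioc (a := (0 : ℝ)) (b := T))] with t ht
      have := ht.1
      positivity
    rw [← intervalIntegral.integral_of_le hT0, intervalIntegral.integral_const_mul,
      integral_rpow (Or.inl (by linarith)), show p - 3 + 1 = p - 2 by ring,
      Real.zero_rpow hp2'.ne', sub_zero]
    have hTp : T ^ (p - 2) = κ⁻¹ ^ (2 * s) * ‖ξ‖ ^ (2 * s) := by
      rw [hT, ← Real.rpow_mul (by positivity), hp2, show d / 2 * (4 * s / d) = 2 * s by
        field_simp; norm_num, Real.mul_rpow (by positivity) (by positivity)]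
    rw [hTp, hG]
    simp only
    rw [← ofReal_norm, ← ENNReal.ofReal_pow (norm_nonneg _), ← ENNReal.ofReal_mul (by positivity)]
    refine le_of_eq (congrArg _ ?_)
    rw [fourierDensity, Real.mul_rpow (by positivity) (norm_nonneg _)]
    field_simp
  refine ne_top_of_le_ne_top ?_ (lintegral_mono hinner)
  exact (hu.const_mul _).lintegral_lt_top.ne

/-! ### Exponential integrability in the critical case N = 2s. -/

/-- The small tail energy is what makes every Gaussian rate attainable. The bound 1 < B keeps the
tail within the radii on which ∫ dy/y is taken from 1. -/
theorem exists_tail_lt {N : ℕ} {s : ℝ} {u : L2 N} (hu : MemHs N s u) {ε : ℝ} (hε : 0 < ε) :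
    ∃ B : ℝ, 1 < B ∧ ∫ ξ in {ξ | B ≤ ‖ξ‖}, fourierDensity N s u ξ < ε := by
  have hmeas : ∀ n : ℕ, MeasurableSet {ξ : RN N | (n : ℝ) ≤ ‖ξ‖} := fun n =>
    measurableSet_le measurable_const measurable_norm
  have h := tendsto_setIntegral_of_antitone (μ := volume) (f := fourierDensity N s u) hmeas
    (fun m n hmn ξ (hξ : (n : ℝ) ≤ ‖ξ‖) => (Nat.cast_le.2 hmn).trans hξ) ⟨0, hu.integrableOn⟩
  have hempty : ⋂ n : ℕ, {ξ : RN N | (n : ℝ) ≤ ‖ξ‖} = ∅ := by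
    ext ξ
    simp only [mem_iInter, mem_ofPred_eq, mem_empty_iff_false, iff_false, not_forall, not_le]
    exact exists_nat_gt _
  rw [hempty, setIntegral_empty] at h
  obtain ⟨n, hn, hn1⟩ := ((h.eventually (gt_mem_nhds hε)).and (Filter.eventually_gt_atTop 1)).exists
  exact ⟨n, by exact_mod_cast hn1, hn⟩

/-- In the critical case `2s = N`, superlevel sets have Gaussian decay of arbitrary rate. -/
theorem exists_measure_le_abs_le_exp {N : ℕ} (hN : 0 < N) {s : ℝ} (hNs : (N : ℝ) = 2 * s)
    {u : L2 N} (hu : MemHs N s u) {γ : ℝ} (hγ : 0 < γ) :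
    ∃ t₀ D : ℝ, 1 ≤ t₀ ∧ 0 ≤ D ∧ ∀ t : ℝ, t₀ ≤ t →
      volume {x | t ≤ |u x|} ≤ ENNReal.ofReal (D * Real.exp (-(γ * t ^ 2))) := by
  have hNr : (0 : ℝ) < N := by exact_mod_cast hN
  obtain ⟨C, hC, hrad⟩ := integral_inv_weight hN s
  set c := γ / N with hc
  have hc0 : 0 < c := by positivity
  -- This threshold, paired with δ = 1/(4Cct), bounds each Young term on the annulus P by t/8. The
  -- ball of radius B adds M ≤ t/4, so the low frequencies total at most t/2.
  obtain ⟨B, hB1, hB⟩ := exists_tail_lt hu (ε := 1 / (16 * C * c)) (by positivity)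
  set M := ∫ ξ in Metric.ball (0 : RN N) B, ‖fourierL2 N u ξ‖ with hM
  set E := DsSq N s u with hE
  have hE0 : 0 ≤ E := integral_nonneg fun ξ => fourierDensity_nonneg u ξ
  refine ⟨max 1 (4 * M), 4 * E, le_max_left _ _, by positivity, fun t ht => ?_⟩
  have ht1 : 1 ≤ t := (le_max_left _ _).trans ht
  have htM : 4 * M ≤ t := (le_max_right _ _).trans ht
  have ht0 : 0 < t := by linarith
  -- The radius has log R = c t², which keeps the low part under control, and R^N = exp(γ t²), which
  -- bounds the weight from below at high frequencies.
  set R := Real.exp (c * t ^ 2) with hR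
  have hR1 : 1 ≤ R := Real.one_le_exp (by positivity)
  have hexp : (N : ℝ) - 1 - 2 * s = -1 := by rw [hNs]; ring
  have hball : ∀ r : ℝ, IntegrableOn (fourierL2 N u) (Metric.ball 0 r) := fun r =>
    integrableOn_fourier_of_measure_ne_top u measure_ball_lt_top.ne
  have hI : IntegrableOn (fun y : ℝ => y ^ ((N : ℝ) - 1 - 2 * s)) (Ioc 1 R) := by
    rw [hexp]
    refine (ContinuousOn.integrableOn_Icc (f := fun y : ℝ => y ^ (-1 : ℝ)) (a := 1) (b := R)
      fun y hy => ?_).mono_set Ioc_subset_Icc_self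
    exact (Real.continuousAt_rpow_const y (-1)
      (Or.inl (by linarith [hy.1]))).continuousWithinAt
  obtain ⟨h1, h2⟩ := hrad _ measurableSet_Ioc (fun y hy => one_pos.trans hy.1) hI
  have hval : ∫ y in Ioc 1 R, y ^ ((N : ℝ) - 1 - 2 * s) = c * t ^ 2 := by
    rw [hexp, ← intervalIntegral.integral_of_le hR1]
    simp_rw [Real.rpow_neg_one]
    rw [integral_inv_of_pos one_pos (by linarith), div_one, hR, Real.log_exp]
  rw [hval] at h2
  set P : Set (RN N) := {ξ | B ≤ ‖ξ‖ ∧ ‖ξ‖ ∈ Ioc 1 R} with hP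
  have hPI : P ⊆ {ξ | ‖ξ‖ ∈ Ioc 1 R} := fun ξ hξ => hξ.2
  have hPB : P ⊆ {ξ | B ≤ ‖ξ‖} := fun ξ hξ => hξ.1
  obtain ⟨h3, h4⟩ := integrableOn_fourier_and_le hN hu (h1.mono_set hPI)
    (δ := 1 / (4 * C * c * t)) (by positivity)
  have h5 : ∫ ξ in P, (weight N s ξ)⁻¹ ≤ C * (c * t ^ 2) := by
    rw [← h2]
    exact setIntegral_mono_set h1
      (Filter.Eventually.of_forall fun ξ => inv_nonneg.2 (weight_nonneg ξ)) hPI.eventuallyLE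
  have h6 : ∫ ξ in P, fourierDensity N s u ξ ≤ 1 / (16 * C * c) := by
    refine le_trans ?_ hB.le
    exact setIntegral_mono_set hu.integrableOn
      (Filter.Eventually.of_forall fun ξ => fourierDensity_nonneg u ξ) hPB.eventuallyLE
  have h7 : ∫ ξ in P, ‖fourierL2 N u ξ‖ ≤ t / 4 := by
    refine h4.trans ?_
    calc _ ≤ 1 / (4 * C * c * t) / 2 * (C * (c * t ^ 2)) +
          1 / (2 * (1 / (4 * C * c * t))) * (1 / (16 * C * c)) := by gcongr
      _ = t / 4 := by field_simp; norm_num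
  have hPm : MeasurableSet P :=
    (measurableSet_le measurable_const measurable_norm).inter (measurable_norm measurableSet_Ioc)
  have hdisj : Disjoint (Metric.ball (0 : RN N) B) P := by
    rw [Set.disjoint_left]
    intro ξ hξ hξ'
    have h8 : ‖ξ‖ < B := by simpa using hξ
    exact absurd hξ'.1 (not_le.2 h8)
  have hcover : Metric.ball (0 : RN N) R ⊆ Metric.ball 0 B ∪ P := by
    intro ξ hξ
    have h8 : ‖ξ‖ < R := by simpa using hξ
    by_cases h9 : ‖ξ‖ < B
    · left; simpa using h9
    · right; exact ⟨not_lt.1 h9, hB1.trans_le (not_lt.1 h9), h8.le⟩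
  have hlow : ∫ ξ in Metric.ball (0 : RN N) R, ‖fourierL2 N u ξ‖ ≤ t / 2 := by
    calc ∫ ξ in Metric.ball (0 : RN N) R, ‖fourierL2 N u ξ‖
        ≤ ∫ ξ in Metric.ball (0 : RN N) B ∪ P, ‖fourierL2 N u ξ‖ :=
          setIntegral_mono_set ((hball B).union h3).norm
            (Filter.Eventually.of_forall fun ξ => norm_nonneg _) hcover.eventuallyLE
      _ = M + ∫ ξ in P, ‖fourierL2 N u ξ‖ := setIntegral_union hdisj hPm (hball B).norm h3.norm
      _ ≤ t / 2 := by linarith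
  refine (measure_le_abs_le u measurableSet_ball (hball R) ht0 hlow).trans ?_
  have hRN : R ^ (N : ℝ) = Real.exp (γ * t ^ 2) := by
    rw [hR, ← Real.exp_mul]
    congr 1
    rw [hc]; field_simp
  have hhigh : ∫⁻ ξ in (Metric.ball (0 : RN N) R)ᶜ, ‖fourierL2 N u ξ‖ₑ ^ 2 ≤
      ENNReal.ofReal (E * Real.exp (-(γ * t ^ 2))) := by
    have hpt : ∀ ξ ∈ (Metric.ball (0 : RN N) R)ᶜ, ‖fourierL2 N u ξ‖ₑ ^ 2 ≤
        ENNReal.ofReal (Real.exp (-(γ * t ^ 2)) * fourierDensity N s u ξ) := by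
      intro ξ hξ
      have h8 : R ≤ ‖ξ‖ := by simpa using hξ
      rw [← ofReal_norm, ← ENNReal.ofReal_pow (norm_nonneg _)]
      refine ENNReal.ofReal_le_ofReal ?_
      have h9 : Real.exp (γ * t ^ 2) ≤ weight N s ξ := by
        rw [← hRN, weight, ← hNs]
        refine Real.rpow_le_rpow (by positivity) ?_ hNr.le
        have := Real.pi_gt_three
        nlinarith
      rw [fourierDensity_eq, ← mul_assoc]
      refine le_mul_of_one_le_left (sq_nonneg _) ?_
      calc (1 : ℝ) = Real.exp (-(γ * t ^ 2)) * Real.exp (γ * t ^ 2) := by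
            rw [← Real.exp_add]; simp
        _ ≤ _ := by gcongr
    refine (setLIntegral_mono' measurableSet_ball.compl hpt).trans ?_
    refine (setLIntegral_le_lintegral _ _).trans ?_
    rw [← ofReal_integral_eq_lintegral_ofReal (hu.const_mul _)
      (Filter.Eventually.of_forall fun ξ =>
        mul_nonneg (Real.exp_nonneg _) (fourierDensity_nonneg u ξ)), integral_const_mul, mul_comm]
    exact le_rfl
  calc _ ≤ ENNReal.ofReal 4 * ENNReal.ofReal (E * Real.exp (-(γ * t ^ 2))) := by
        gcongr
        exact div_le_self (by norm_num) (one_le_pow₀ ht1)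
    _ = _ := by rw [← ENNReal.ofReal_mul (by norm_num), mul_assoc]

/-- In the critical case `2s = N`, `exp (β u²)` is integrable where `|u|` is large. -/
theorem exists_integrableOn_exp_sq {N : ℕ} (hN : 0 < N) {s : ℝ} (hNs : (N : ℝ) = 2 * s)
    {u : L2 N} (hu : MemHs N s u) {β : ℝ} (hβ : 0 < β) :
    ∃ n₀ : ℕ, IntegrableOn (fun x => Real.exp (β * u x ^ 2)) {x | (n₀ : ℝ) ≤ |u x|} := by
  -- On the layer m ≤ |u| ≤ m + 1 with m ≥ 1, (m + 1)² ≤ 4m². The rate 4β + 1 therefore leaves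
  -- exp(-m²), which is summable.
  obtain ⟨t₀, D, ht₀, hD, hdecay⟩ :=
    exists_measure_le_abs_le_exp hN hNs hu (γ := 4 * β + 1) (by positivity)
  obtain ⟨n₀, hn₀⟩ := exists_nat_ge t₀
  refine ⟨n₀, ?_⟩
  have hum : Measurable u := (Lp.stronglyMeasurable u).measurable
  have hlevel : ∀ n : ℕ, MeasurableSet {x | (n : ℝ) ≤ |u x|} := fun n =>
    measurableSet_le measurable_const hum.abs
  have hmeas : Measurable fun x => Real.exp (β * u x ^ 2) :=
    ((hum.pow_const 2).const_mul β).exp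
  refine (lintegral_ofReal_ne_top_iff_integrable hmeas.aestronglyMeasurable
    (Filter.Eventually.of_forall fun x => (Real.exp_nonneg _))).1 ?_
  have hpt : ∀ x ∈ {x | (n₀ : ℝ) ≤ |u x|}, ENNReal.ofReal (Real.exp (β * u x ^ 2)) ≤
      ∑' n : ℕ, ({x | ((n + n₀ : ℕ) : ℝ) ≤ |u x|}).indicator
        (fun _ => ENNReal.ofReal (Real.exp (β * ((n + n₀ : ℕ) + 1) ^ 2))) x := by
    intro x (hx : (n₀ : ℝ) ≤ |u x|)
    have hle : n₀ ≤ ⌊|u x|⌋₊ := Nat.le_floor hx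
    obtain ⟨k, hk⟩ := Nat.exists_eq_add_of_le hle
    have h1 : ((k + n₀ : ℕ) : ℝ) ≤ |u x| := by
      rw [add_comm, ← hk]; exact Nat.floor_le (abs_nonneg _)
    have h2 : |u x| ≤ ((k + n₀ : ℕ) : ℝ) + 1 := by
      rw [add_comm k, ← hk]; exact (Nat.lt_floor_add_one _).le
    refine le_trans ?_ (ENNReal.le_tsum k)
    rw [indicator_of_mem (show x ∈ {x | ((k + n₀ : ℕ) : ℝ) ≤ |u x|} from h1)]
    refine ENNReal.ofReal_le_ofReal (Real.exp_le_exp.2 ?_)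
    rw [← sq_abs (u x)]
    gcongr
  refine ne_top_of_le_ne_top ?_ ((setLIntegral_mono' (hlevel n₀) hpt).trans
    (setLIntegral_le_lintegral _ _))
  rw [lintegral_tsum fun n => (measurable_const.indicator (hlevel _)).aemeasurable]
  have hsum : Summable fun n : ℕ => D * Real.exp (-(n : ℝ)) := by
    refine Summable.mul_left _ ?_
    simpa using Real.summable_exp_nat_mul_iff.2 (show (-1 : ℝ) < 0 by norm_num)
  refine ne_top_of_le_ne_top hsum.tsum_ofReal_ne_top (ENNReal.tsum_le_tsum fun n => ?_)
  rw [lintegral_indicator_const (hlevel _)]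
  set m : ℝ := ((n + n₀ : ℕ) : ℝ) with hm
  have hmn : (n : ℝ) ≤ m := by rw [hm]; push_cast; linarith [n₀.cast_nonneg (α := ℝ)]
  have hmt : t₀ ≤ m := by rw [hm]; push_cast; linarith [n.cast_nonneg (α := ℝ)]
  have hm1 : 1 ≤ m := ht₀.trans hmt
  refine (mul_le_mul_right (hdecay m hmt) _).trans ?_
  rw [← ENNReal.ofReal_mul (Real.exp_nonneg _)]
  refine ENNReal.ofReal_le_ofReal ?_
  rw [mul_left_comm, ← Real.exp_add]
  refine mul_le_mul_of_nonneg_left (Real.exp_le_exp.2 ?_) hD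
  have h1 : (m + 1) ^ 2 ≤ 4 * m ^ 2 := by nlinarith
  have h2 := mul_le_mul_of_nonneg_left h1 hβ.le
  nlinarith

/-! ### Integrability of F(u) in the three growth regimes. -/

theorem abs_primitive_le {f : ℝ → ℝ} {t b : ℝ} (h : ∀ r : ℝ, |r| ≤ |t| → |f r| ≤ b) :
    |primitive f t| ≤ b * |t| := by
  have := intervalIntegral.norm_integral_le_of_norm_le_const (a := 0) (b := t) (f := f) (C := b)
    fun r hr => h r ?_
  · simpa [primitive] using this
  · rcases le_total 0 t with ht | ht
    · rw [uIoc_of_le ht] at hr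
      rw [abs_of_pos hr.1, abs_of_nonneg ht]; exact hr.2
    · rw [uIoc_of_ge ht] at hr
      rw [abs_of_nonpos hr.2, abs_of_nonpos ht]; linarith [hr.1]

theorem hasDerivAt_primitive {f : ℝ → ℝ} (hf : Continuous f) (t : ℝ) :
    HasDerivAt (primitive f) (f t) t :=
  intervalIntegral.integral_hasDerivAt_right (hf.intervalIntegrable _ _)
    (hf.stronglyMeasurableAtFilter _ _) hf.continuousAt

theorem continuous_primitive_of_continuous {f : ℝ → ℝ} (hf : Continuous f) : Continuous (primitive f) :=
  continuous_iff_continuousAt.2 fun t => (hasDerivAt_primitive hf t).continuousAt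

/-- Under the growth assumption, `F(u)` is integrable for every `u ∈ H^s`. -/
theorem integrable_primitive_comp {N : ℕ} (hN : 0 < N) {s : ℝ} (hs : 0 < s) {f : ℝ → ℝ}
    (hf : Growth N s f) {u : L2 N} (hu : MemHs N s u) :
    Integrable fun x => primitive f (u x) := by
  have hum : Measurable u := (Lp.stronglyMeasurable u).measurable
  have hmeas : AEStronglyMeasurable (fun x => primitive f (u x)) volume :=
    ((continuous_primitive_of_continuous hf.continuous).measurable.comp hum).aestronglyMeasurable
  have hsq := integrable_sq u
  rcases lt_trichotomy (N : ℝ) (2 * s) with h | h | h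
  · obtain ⟨M, hM⟩ := exists_ae_abs_le hN h hu
    obtain ⟨C, hC⟩ := hf.subcritical h
    obtain ⟨C', hC'⟩ := (isCompact_Icc (a := -M) (b := M)).exists_bound_of_continuousOn
      hf.continuous.continuousOn
    have hbd : ∀ r : ℝ, |r| ≤ M → |f r| ≤ max C C' * |r| := by
      intro r hr
      by_cases h1 : |r| ≤ 1
      · exact (hC r (abs_le.1 h1)).trans (by gcongr; exact le_max_left _ _)
      · have h2 : |f r| ≤ C' := hC' r (abs_le.1 hr)
        have h3 : 0 ≤ C' := (abs_nonneg _).trans h2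
        push Not at h1
        calc |f r| ≤ max C C' * 1 := by rw [mul_one]; exact h2.trans (le_max_right _ _)
          _ ≤ max C C' * |r| := by
            have : 0 ≤ max C C' := h3.trans (le_max_right _ _)
            gcongr
    refine Integrable.mono' (hsq.const_mul (max (max C C') 0)) hmeas ?_
    filter_upwards [hM] with x hx
    have := abs_primitive_le (f := f) (t := u x) (b := max (max C C') 0 * |u x|) fun r hr =>
      (hbd r (hr.trans hx)).trans (by
        calc max C C' * |r| ≤ max (max C C') 0 * |r| :=
            mul_le_mul_of_nonneg_right (le_max_left _ _) (abs_nonneg _)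
          _ ≤ _ := by gcongr)
    rwa [mul_assoc, abs_mul_abs_self, ← sq] at this
  -- For q = 2 the growth bound collapses to C|t| exp(α t²). The absolute value in α makes α
  -- positive.
  · obtain ⟨C, hC⟩ := hf.exponential h 2 le_rfl (|alphaN N| + 1)
      (by linarith [le_abs_self (alphaN N)])
    set α := |alphaN N| + 1 with hα
    have hα0 : 0 < α := by positivity
    -- The extra 1 in the exponent absorbs the factor u² through u² ≤ exp(u²).
    obtain ⟨n₀, hn₀⟩ := exists_integrableOn_exp_sq hN h hu (β := α + 1) (by positivity)
    have hset : MeasurableSet {x | (n₀ : ℝ) ≤ |u x|} := measurableSet_le measurable_const hum.abs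
    have hC0 : 0 ≤ max C 0 := le_max_right _ _
    have hbd : ∀ t : ℝ, |primitive f t| ≤ max C 0 * Real.exp (α * t ^ 2) * t ^ 2 := by
      intro t
      have := abs_primitive_le (f := f) (t := t) (b := max C 0 * (|t| * Real.exp (α * t ^ 2)))
        fun r hr => (hC r).trans (by
          have h1 : |r| ^ ((2 : ℝ) - 1) = |r| := by norm_num
          rw [h1]
          have h2 : |r| + |r| * (Real.exp (α * r ^ 2) - 1) = |r| * Real.exp (α * r ^ 2) := by ring
          rw [h2]
          have h3 : r ^ 2 ≤ t ^ 2 := sq_le_sq.2 hr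
          have h4 : C ≤ max C 0 := le_max_left _ _
          gcongr)
      calc _ ≤ _ := this
        _ = max C 0 * Real.exp (α * t ^ 2) * (|t| * |t|) := by ring
        _ = _ := by rw [abs_mul_abs_self, ← sq]
    refine Integrable.mono' (((hsq.const_mul (max C 0 * Real.exp (α * (n₀ : ℝ) ^ 2)))).add
      (((integrable_indicator_iff hset).2 hn₀).const_mul (max C 0))) hmeas
      (Filter.Eventually.of_forall fun x => (hbd _).trans ?_)
    by_cases hx : (n₀ : ℝ) ≤ |u x|
    · rw [Pi.add_apply, indicator_of_mem (show x ∈ {x | (n₀ : ℝ) ≤ |u x|} from hx)]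
      have h1 : u x ^ 2 ≤ Real.exp (u x ^ 2) := by linarith [Real.add_one_le_exp (u x ^ 2)]
      have h2 : Real.exp ((α + 1) * u x ^ 2) = Real.exp (α * u x ^ 2) * Real.exp (u x ^ 2) := by
        rw [← Real.exp_add]; ring_nf
      calc max C 0 * Real.exp (α * u x ^ 2) * u x ^ 2
          ≤ max C 0 * Real.exp (α * u x ^ 2) * Real.exp (u x ^ 2) := by gcongr
        _ = max C 0 * Real.exp ((α + 1) * u x ^ 2) := by rw [h2]; ring
        _ ≤ _ := le_add_of_nonneg_left (by positivity)
    · rw [Pi.add_apply, indicator_of_notMem (show x ∉ {x | (n₀ : ℝ) ≤ |u x|} from hx), mul_zero,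
        add_zero]
      have h1 : u x ^ 2 ≤ (n₀ : ℝ) ^ 2 := by
        rw [← sq_abs (u x)]; push Not at hx; gcongr
      gcongr
  · obtain ⟨C, hC⟩ := hf.sobolev h
    set p := 2 * (N : ℝ) / (N - 2 * s) with hp
    have hd : 0 < (N : ℝ) - 2 * s := by linarith
    have hp1 : 1 < p := by rw [hp, lt_div_iff₀ hd]; linarith [N.cast_nonneg (α := ℝ)]
    refine Integrable.mono' ((hsq.add (integrable_abs_rpow_sobolev hN hs h hu)).const_mul
      (max C 0)) hmeas (Filter.Eventually.of_forall fun x => ?_)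
    have := abs_primitive_le (f := f) (t := u x) (b := max C 0 * (|u x| + |u x| ^ (p - 1)))
      fun r hr => (hC r).trans (by
        have h3 : |r| ^ (p - 1) ≤ |u x| ^ (p - 1) :=
          Real.rpow_le_rpow (abs_nonneg _) hr (by linarith)
        have h4 : C ≤ max C 0 := le_max_left _ _
        gcongr)
    refine this.trans (le_of_eq ?_)
    have h5 : |u x| ^ (p - 1) * |u x| = |u x| ^ p := by
      rcases eq_or_lt_of_le (abs_nonneg (u x)) with h0 | h0
      · rw [← h0, Real.zero_rpow (by linarith), Real.zero_rpow (by linarith), zero_mul]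
      · rw [Real.rpow_sub_one h0.ne']; field_simp
    rw [Pi.add_apply, mul_assoc, add_mul, h5, abs_mul_abs_self, ← sq]

/-! ### Rescaling a u(c ·) and its effect on each term. -/

theorem quasiMeasurePreserving_smul {N : ℕ} {c : ℝ} (hc : c ≠ 0) :
    Measure.QuasiMeasurePreserving (fun x : RN N => c • x) volume volume := by
  refine ⟨measurable_const_smul c, ?_⟩
  rw [Measure.map_addHaar_smul _ hc]
  exact Measure.smul_absolutelyContinuous

theorem memLp_comp_smul {N : ℕ} {E : Type*} [NormedAddCommGroup E] {g : RN N → E}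
    (hg : MemLp g 2) {c : ℝ} (hc : c ≠ 0) : MemLp (fun x => g (c • x)) 2 := by
  have h : MemLp g 2 (Measure.map (fun x : RN N => c • x) volume) := by
    rw [Measure.map_addHaar_smul _ hc]
    exact hg.smul_measure ENNReal.ofReal_ne_top
  exact h.comp_of_map (measurable_const_smul c).aemeasurable

/-- The rescaled function `a u(c ·)`. -/
noncomputable def rescale {N : ℕ} (a c : ℝ) (hc : c ≠ 0) (u : L2 N) : L2 N :=
  ((memLp_comp_smul (Lp.memLp u) hc).const_mul a).toLp (fun x => a * u (c • x))

theorem coeFn_rescale {N : ℕ} (a c : ℝ) (hc : c ≠ 0) (u : L2 N) :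
    rescale a c hc u =ᵐ[volume] fun x => a * u (c • x) :=
  MemLp.coeFn_toLp _

theorem integral_RN_comp_smul {N : ℕ} {E : Type*} [NormedAddCommGroup E] [NormedSpace ℝ E]
    (g : RN N → E) {c : ℝ} (hc : 0 < c) :
    ∫ x, g (c • x) = (c ^ N)⁻¹ • ∫ x, g x := by
  have := Measure.integral_comp_smul_of_nonneg (volume : Measure (RN N)) g c (hR := hc.le)
  simpa using this

theorem fourier_comp_smul {N : ℕ} (φ : RN N → ℂ) {c : ℝ} (hc : 0 < c) (y : RN N) :
    𝓕 (fun x => φ (c • x)) y = (c ^ N)⁻¹ • 𝓕 φ (c⁻¹ • y) := by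
  rw [Real.fourier_eq, Real.fourier_eq, ← integral_RN_comp_smul _ hc]
  congr 1; ext x
  rw [inner_smul_left, inner_smul_right]
  simp only [RCLike.conj_to_real]
  rw [← mul_assoc, mul_inv_cancel₀ hc.ne', one_mul]

/-- The integral formula does not apply to a general L² function, so both sides are tested against
Schwartz functions, and the transform and the dilation are moved to the test function. -/
theorem fourierL2_rescale {N : ℕ} (a : ℝ) {c : ℝ} (hc : 0 < c) (u : L2 N) :
    fourierL2 N (rescale a c hc.ne' u) =ᵐ[volume]
      fun ξ => (a * (c ^ N)⁻¹ : ℝ) • fourierL2 N u (c⁻¹ • ξ) := by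
  have hmem : MemLp (fun ξ => (a * (c ^ N)⁻¹ : ℝ) • fourierL2 N u (c⁻¹ • ξ)) 2 :=
    (memLp_comp_smul (Lp.memLp (fourierL2 N u)) (inv_ne_zero hc.ne')).const_smul (a * (c ^ N)⁻¹ : ℝ)
  refine ae_eq_of_integral_schwartz_smul_eq (locallyIntegrable_Lp _)
    (hmem.locallyIntegrable (by norm_num)) fun φ => ?_
  set U : Lp ℂ 2 (volume : Measure (RN N)) := Complex.ofRealCLM.compLp u with hU
  set ψ : 𝓢(RN N, ℂ) := SchwartzMap.compCLMOfContinuousLinearEquiv ℂ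
    (ContinuousLinearEquiv.smulLeft (Units.mk0 c hc.ne')) φ with hψ
  have hψφ : ∀ x, ψ x = φ (c • x) := fun x => rfl
  have hFψ : ∀ y, (𝓕 ψ) y = (c ^ N)⁻¹ • (𝓕 φ) (c⁻¹ • y) := by
    intro y
    rw [SchwartzMap.fourier_coe, SchwartzMap.fourier_coe]
    exact fourier_comp_smul φ hc y
  have h1 : ∫ x, φ x • fourierL2 N (rescale a c hc.ne' u) x
      = ∫ x, a • ((𝓕 φ) (c⁻¹ • (c • x)) • U (c • x)) := by
    rw [fourierL2, integral_schwartz_smul_fourier]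
    refine integral_congr_ae ?_
    filter_upwards [Complex.ofRealCLM.coeFn_compLp (rescale a c hc.ne' u),
      coeFn_rescale a c hc.ne' u, (quasiMeasurePreserving_smul hc.ne').ae
        (Complex.ofRealCLM.coeFn_compLp u)] with x h1 h2 h3
    rw [h1, h2, h3, inv_smul_smul₀ hc.ne']
    simp only [Complex.ofRealCLM_apply, smul_eq_mul, Complex.real_smul]
    push_cast; ring
  have h2 : ∫ x, φ x • fourierL2 N u (c⁻¹ • x) = (c ^ N) • ∫ x, ψ x • fourierL2 N u x := by
    have := integral_RN_comp_smul (fun x => φ x • fourierL2 N u (c⁻¹ • x)) hc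
    simp only [inv_smul_smul₀ hc.ne'] at this
    simp only [hψφ]
    rw [this, smul_smul, mul_inv_cancel₀ (by positivity), one_smul]
  have h5 := integral_RN_comp_smul (fun x => a • ((𝓕 φ) (c⁻¹ • x) • U x)) hc
  rw [h1]
  refine h5.trans ?_
  have h3 : ∀ x, φ x • ((a * (c ^ N)⁻¹ : ℝ) • fourierL2 N u (c⁻¹ • x))
      = (a * (c ^ N)⁻¹ : ℝ) • (φ x • fourierL2 N u (c⁻¹ • x)) := fun x => smul_comm _ _ _
  simp only [h3]
  rw [integral_smul, integral_smul, h2]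
  have h4 : ∫ x, ψ x • fourierL2 N u x = (c ^ N)⁻¹ • ∫ x, (𝓕 φ) (c⁻¹ • x) • U x := by
    rw [fourierL2, integral_schwartz_smul_fourier, ← integral_smul]
    congr 1; ext x
    rw [hFψ, smul_assoc]
  rw [h4, smul_smul, smul_smul, smul_smul]
  congr 1
  have : c ^ N ≠ 0 := by positivity
  field_simp

theorem fourierDensity_rescale {N : ℕ} (s a : ℝ) {c : ℝ} (hc : 0 < c) (u : L2 N) :
    fourierDensity N s (rescale a c hc.ne' u) =ᵐ[volume]
      fun ξ => (a * (c ^ N)⁻¹) ^ 2 * c ^ (2 * s) * fourierDensity N s u (c⁻¹ • ξ) := by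
  filter_upwards [fourierL2_rescale a hc u] with ξ hξ
  rw [fourierDensity, fourierDensity, hξ, norm_smul, mul_pow, Real.norm_eq_abs, sq_abs, norm_smul,
    Real.norm_of_nonneg (inv_nonneg.2 hc.le)]
  have h : (2 * Real.pi * ‖ξ‖) ^ (2 * s)
      = c ^ (2 * s) * (2 * Real.pi * (c⁻¹ * ‖ξ‖)) ^ (2 * s) := by
    have := Real.pi_pos
    rw [← Real.mul_rpow hc.le (by positivity)]
    congr 1
    field_simp
  rw [h]; ring

theorem memHs_rescale {N : ℕ} {s : ℝ} (a : ℝ) {c : ℝ} (hc : 0 < c) {u : L2 N} (hu : MemHs N s u) :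
    MemHs N s (rescale a c hc.ne' u) :=
  ((hu.comp_smul (inv_ne_zero hc.ne')).const_mul _).congr (fourierDensity_rescale s a hc u).symm

theorem dsSq_rescale {N : ℕ} (s a : ℝ) {c : ℝ} (hc : 0 < c) (u : L2 N) :
    DsSq N s (rescale a c hc.ne' u) = a ^ 2 * (c ^ (2 * s) * (c ^ N)⁻¹) * DsSq N s u := by
  rw [DsSq, integral_congr_ae (fourierDensity_rescale s a hc u), integral_const_mul,
    integral_RN_comp_smul _ (inv_pos.2 hc), DsSq, smul_eq_mul, inv_pow, inv_inv]
  have : c ^ N ≠ 0 := by positivity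
  field_simp

theorem normY_smul {N K : ℕ} {c : ℝ} (hc : 0 < c) (x : RN N) :
    normY N K (c • x) = c * normY N K x := by
  have h : ∀ i : Fin N, (if i.val < K then (c • x) i ^ 2 else 0)
      = c ^ 2 * (if i.val < K then x i ^ 2 else 0) := by
    intro i
    split_ifs <;> simp [mul_pow]
  rw [normY, normY, Finset.sum_congr rfl fun i _ => h i, ← Finset.mul_sum,
    Real.sqrt_mul (by positivity), Real.sqrt_sq hc.le]

/-- The Hardy density `u² / |y|^{2s}`. -/
noncomputable def hardy (N K : ℕ) (s : ℝ) (u : L2 N) (x : RN N) : ℝ :=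
  u x ^ 2 / normY N K x ^ (2 * s)

theorem hardy_rescale {N : ℕ} (K : ℕ) (s a : ℝ) {c : ℝ} (hc : 0 < c) (u : L2 N) :
    hardy N K s (rescale a c hc.ne' u) =ᵐ[volume]
      fun x => a ^ 2 * c ^ (2 * s) * hardy N K s u (c • x) := by
  filter_upwards [coeFn_rescale a c hc.ne' u] with x hx
  have hn : 0 ≤ normY N K x := Real.sqrt_nonneg _
  rw [hardy, hardy, hx, normY_smul hc, Real.mul_rpow hc.le hn]
  have : c ^ (2 * s) ≠ 0 := by positivity
  field_simp

theorem integral_hardy_rescale {N : ℕ} (K : ℕ) (s μ a : ℝ) {c : ℝ} (hc : 0 < c) (u : L2 N) :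
    ∫ x, μ * hardy N K s (rescale a c hc.ne' u) x
      = a ^ 2 * (c ^ (2 * s) * (c ^ N)⁻¹) * ∫ x, μ * hardy N K s u x := by
  rw [integral_const_mul, integral_congr_ae (hardy_rescale K s a hc u), integral_const_mul,
    integral_RN_comp_smul _ hc, integral_const_mul, smul_eq_mul]
  ring

theorem memX_rescale {N K : ℕ} {s μ : ℝ} (a : ℝ) {c : ℝ} (hc : 0 < c) {u : L2 N}
    (hu : MemX N K s μ u) : MemX N K s μ (rescale a c hc.ne' u) := by
  refine ⟨memHs_rescale a hc hu.1, ?_⟩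
  have h : Integrable fun x => |μ| * hardy N K s u x := hu.2
  refine ((h.comp_smul hc.ne').const_mul (a ^ 2 * c ^ (2 * s))).congr ?_
  filter_upwards [hardy_rescale K s a hc u] with x hx
  change _ = |μ| * hardy N K s (rescale a c hc.ne' u) x
  rw [hx]; ring

theorem integral_sq_rescale {N : ℕ} (a : ℝ) {c : ℝ} (hc : 0 < c) (u : L2 N) :
    ∫ x, rescale a c hc.ne' u x ^ 2 = a ^ 2 * (c ^ N)⁻¹ * ∫ x, u x ^ 2 := by
  have h : (fun x => rescale a c hc.ne' u x ^ 2) =ᵐ[volume] fun x => a ^ 2 * u (c • x) ^ 2 := by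
    filter_upwards [coeFn_rescale a c hc.ne' u] with x hx
    rw [hx, mul_pow]
  rw [integral_congr_ae h, integral_const_mul, integral_RN_comp_smul (fun x => u x ^ 2) hc,
    smul_eq_mul, mul_assoc]

theorem integral_primitive_rescale {N : ℕ} (f : ℝ → ℝ) (a : ℝ) {c : ℝ} (hc : 0 < c) (u : L2 N) :
    ∫ x, primitive f (rescale a c hc.ne' u x) = (c ^ N)⁻¹ * ∫ x, primitive f (a * u x) := by
  have h : (fun x => primitive f (rescale a c hc.ne' u x)) =ᵐ[volume]
      fun x => primitive f (a * u (c • x)) := by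
    filter_upwards [coeFn_rescale a c hc.ne' u] with x hx
    rw [hx]
  rw [integral_congr_ae h, integral_RN_comp_smul (fun x => primitive f (a * u x)) hc, smul_eq_mul]

theorem integrable_primitive_mul {N : ℕ} (hN : 0 < N) {s : ℝ} (hs : 0 < s) {f : ℝ → ℝ}
    (hf : Growth N s f) {u : L2 N} (hu : MemHs N s u) (a : ℝ) :
    Integrable fun x => primitive f (a * u x) := by
  refine (integrable_primitive_comp hN hs hf (memHs_rescale a one_pos hu)).congr ?_
  filter_upwards [coeFn_rescale a 1 one_ne_zero u] with x hx
  rw [hx, one_smul]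

/-! ### Invariance under O(K). -/

theorem blockExt_mul {N K : ℕ} (hKN : K ≤ N) (g h : Matrix (Fin K) (Fin K) ℝ) :
    blockExt N K g * blockExt N K h = blockExt N K (g * h) := by
  obtain ⟨M, rfl⟩ := Nat.exists_eq_add_of_le hKN
  have key : ∀ g : Matrix (Fin K) (Fin K) ℝ, blockExt (K + M) K g =
      (Matrix.fromBlocks g 0 0 (1 : Matrix (Fin M) (Fin M) ℝ)).submatrix
        finSumFinEquiv.symm finSumFinEquiv.symm := by
    intro g
    ext i j
    obtain ⟨i, rfl⟩ := finSumFinEquiv.surjective i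
    obtain ⟨j, rfl⟩ := finSumFinEquiv.surjective j
    rcases i with i | i <;> rcases j with j | j <;>
      simp [blockExt, Matrix.one_apply, Fin.ext_iff]
    all_goals omega
  rw [key, key, key, Matrix.submatrix_mul_equiv, Matrix.fromBlocks_multiply]
  simp

theorem blockExt_one {N K : ℕ} : blockExt N K 1 = 1 := by
  ext i j
  simp only [blockExt, Matrix.one_apply, Fin.ext_iff]
  split_ifs <;> simp_all

/-- Needed to substitute a rotated point into almost-everywhere identities. A nonzero determinant
suffices, and the block extension of `star g` provides the inverse. -/
theorem quasiMeasurePreserving_blockExt {N K : ℕ} (hKN : K ≤ N) {g : Matrix (Fin K) (Fin K) ℝ}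
    (hg : g ∈ Matrix.orthogonalGroup (Fin K) ℝ) :
    Measure.QuasiMeasurePreserving
      (fun x : RN N => Matrix.toEuclideanLin (blockExt N K g) x) volume volume := by
  have h1 : blockExt N K g * blockExt N K (star g) = 1 := by
    rw [blockExt_mul hKN, Unitary.mul_star_self_of_mem hg, blockExt_one]
  have hdet : LinearMap.det (Matrix.toEuclideanLin (blockExt N K g)) ≠ 0 := by
    have h2 : (blockExt N K g).det ≠ 0 := by
      intro h0
      have := congrArg Matrix.det h1
      rw [Matrix.det_mul, h0, zero_mul, Matrix.det_one] at this
      exact zero_ne_one this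
    have h3 : Matrix.toEuclideanLin (blockExt N K g)
        = Matrix.toLin (PiLp.basisFun 2 ℝ (Fin N)) (PiLp.basisFun 2 ℝ (Fin N)) (blockExt N K g) :=
      LinearEquiv.congr_fun (Matrix.toLpLin_eq_toLin 2 2) _
    rwa [h3, LinearMap.det_toLin]
  refine ⟨(LinearMap.continuous_of_finiteDimensional _).measurable, ?_⟩
  rw [Measure.map_linearMap_addHaar_eq_smul_addHaar _ hdet]
  exact Measure.smul_absolutelyContinuous

theorem isInvariant_rescale {N K : ℕ} (hKN : K ≤ N) (a : ℝ) {c : ℝ} (hc : 0 < c) {u : L2 N}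
    (hu : IsInvariant N K u) : IsInvariant N K (rescale a c hc.ne' u) := by
  intro g hg
  have hco := coeFn_rescale a c hc.ne' u
  filter_upwards [hco, (quasiMeasurePreserving_blockExt hKN hg).ae hco,
    (quasiMeasurePreserving_smul hc.ne').ae (hu g hg)] with x h1 h2 h3
  rw [h1, h2, ← h3, map_smul]

/-! ### Scaling of J and monotonicity of a^(-p) F(a t). -/

/-- The quadratic part of `J` scales homogeneously. -/
theorem J_rescale {N K : ℕ} (s μ : ℝ) (f : ℝ → ℝ) (a : ℝ) {c : ℝ} (hc : 0 < c) (u : L2 N) :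
    J N K s μ f (rescale a c hc.ne' u) = a ^ 2 * (c ^ (2 * s) * (c ^ N)⁻¹) *
        (1 / 2 * (DsSq N s u + ∫ x : RN N, μ * (u x ^ 2 / normY N K x ^ (2 * s))))
      - (c ^ N)⁻¹ * ∫ x, primitive f (a * u x) := by
  have h := integral_hardy_rescale K s μ a hc u
  simp only [hardy] at h
  rw [J, h, dsSq_rescale s a hc, integral_primitive_rescale f a hc]
  ring

theorem primitive_zero (f : ℝ → ℝ) : primitive f 0 = 0 := by simp [primitive]

theorem rescale_zero_left {N : ℕ} {c : ℝ} (hc : c ≠ 0) (u : L2 N) : rescale 0 c hc u = 0 := by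
  refine Lp.ext_iff.2 ?_
  filter_upwards [coeFn_rescale 0 c hc u, Lp.coeFn_zero ℝ 2 (volume : Measure (RN N))] with x h1 h2
  rw [h1, h2]; simp

theorem J_zero {N K : ℕ} {s : ℝ} (μ : ℝ) (f : ℝ → ℝ) : J N K s μ f (0 : L2 N) = 0 := by
  have h := J_rescale (K := K) s μ f 0 one_pos (0 : L2 N)
  rw [rescale_zero_left] at h
  simpa [primitive_zero] using h

theorem primitive_neg (f : ℝ → ℝ) (t : ℝ) : primitive (-f) t = -primitive f t := by
  simp [primitive]

/-- If `p F(t) < f(t) t`, then `a ↦ a^{-p} F(a t)` is strictly increasing on `(0, ∞)`. -/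
theorem strictMonoOn_rpow_neg_mul_primitive {f : ℝ → ℝ} (hf : Continuous f) {p : ℝ}
    (h : ∀ t : ℝ, t ≠ 0 → p * primitive f t < f t * t) {t : ℝ} (ht : t ≠ 0) :
    StrictMonoOn (fun a : ℝ => a ^ (-p) * primitive f (a * t)) (Ioi 0) := by
  have hder : ∀ a : ℝ, 0 < a → HasDerivAt (fun a : ℝ => a ^ (-p) * primitive f (a * t))
      (-p * a ^ (-p - 1) * primitive f (a * t) + a ^ (-p) * (f (a * t) * t)) a := by
    intro a ha
    have h1 := Real.hasDerivAt_rpow_const (x := a) (p := -p) (Or.inl ha.ne')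
    have h2 : HasDerivAt (fun a : ℝ => primitive f (a * t)) (f (a * t) * t) a :=
      HasDerivAt.comp (h₂ := primitive f) a (hasDerivAt_primitive hf (a * t)) (hasDerivAt_mul_const t)
    exact h1.mul h2
  refine strictMonoOn_of_deriv_pos (convex_Ioi 0)
    (fun a ha => (hder a ha).continuousAt.continuousWithinAt) fun a ha => ?_
  rw [interior_Ioi] at ha
  have ha0 : 0 < a := ha
  rw [(hder a ha).deriv]
  have h3 := h (a * t) (mul_ne_zero ha0.ne' ht)
  have h4 : a ^ (-p) = a ^ (-p - 1) * a := by
    rw [← Real.rpow_add_one ha0.ne']; congr 1; ring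
  have h5 : -p * a ^ (-p - 1) * primitive f (a * t) + a ^ (-p) * (f (a * t) * t)
      = a ^ (-p - 1) * (f (a * t) * (a * t) - p * primitive f (a * t)) := by rw [h4]; ring
  rw [h5]
  have : 0 < a ^ (-p - 1) := Real.rpow_pos_of_pos ha0 _
  exact mul_pos this (by linarith)

theorem rpow_mul_primitive_lt_of_one_lt {f : ℝ → ℝ} (hf : Continuous f) {p : ℝ}
    (h : ∀ t : ℝ, t ≠ 0 → p * primitive f t < f t * t) {t : ℝ} (ht : t ≠ 0) {a : ℝ} (ha : 1 < a) :
    a ^ p * primitive f t < primitive f (a * t) := by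
  have ha0 : 0 < a := one_pos.trans ha
  have := strictMonoOn_rpow_neg_mul_primitive hf h ht (mem_Ioi.2 one_pos) (mem_Ioi.2 ha0) ha
  simp only [Real.one_rpow, one_mul] at this
  rwa [Real.rpow_neg ha0.le, lt_inv_mul_iff₀ (by positivity)] at this

theorem primitive_lt_rpow_mul_of_lt_one {f : ℝ → ℝ} (hf : Continuous f) {p : ℝ}
    (h : ∀ t : ℝ, t ≠ 0 → p * primitive f t < f t * t) {t : ℝ} (ht : t ≠ 0) {a : ℝ} (ha0 : 0 < a)
    (ha : a < 1) : primitive f (a * t) < a ^ p * primitive f t := by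
  have := strictMonoOn_rpow_neg_mul_primitive hf h ht (mem_Ioi.2 ha0) (mem_Ioi.2 one_pos) ha
  simp only [Real.one_rpow, one_mul] at this
  rwa [Real.rpow_neg ha0.le, inv_mul_lt_iff₀ (by positivity)] at this

/-- Replacing f by -f reverses the hypothesis, which reduces this to the opposite alternative. -/
theorem rpow_mul_primitive_lt_of_lt_one {f : ℝ → ℝ} (hf : Continuous f) {p : ℝ}
    (h : ∀ t : ℝ, t ≠ 0 → f t * t < p * primitive f t) {t : ℝ} (ht : t ≠ 0) {a : ℝ} (ha0 : 0 < a)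
    (ha : a < 1) : a ^ p * primitive f t < primitive f (a * t) := by
  have := primitive_lt_rpow_mul_of_lt_one (f := -f) hf.neg (p := p) (fun t ht => by
    rw [primitive_neg, Pi.neg_apply]; linarith [h t ht]) ht ha0 ha
  rw [primitive_neg, primitive_neg] at this
  linarith

/-- Strictness survives integration because u ≠ 0 on a set of positive measure; where u = 0 both
integrands vanish. -/
theorem integral_rpow_mul_primitive_lt {N : ℕ} {f : ℝ → ℝ} {u : L2 N} (hu : u ≠ 0) {a b : ℝ}
    (h1 : Integrable fun x => primitive f (u x)) (h2 : Integrable fun x => primitive f (a * u x))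
    (hlt : ∀ t : ℝ, t ≠ 0 → b * primitive f t < primitive f (a * t)) :
    b * ∫ x, primitive f (u x) < ∫ x, primitive f (a * u x) := by
  rw [← integral_const_mul]
  rw [← sub_pos, ← integral_sub h2 (h1.const_mul b)]
  refine (integral_pos_iff_support_of_nonneg ?_ (h2.sub (h1.const_mul b))).2
    (pos_iff_ne_zero.2 ?_)
  rotate_left
  · intro h0
    refine hu ((Lp.eq_zero_iff_ae_eq_zero).2 (measure_mono_null (fun x (hx : ¬ (u x = 0)) => ?_) h0))
    exact (sub_pos.2 (hlt _ hx)).ne'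
  · intro x
    by_cases hx : u x = 0
    · simp [hx, primitive_zero]
    · exact (sub_pos.2 (hlt _ hx)).le

/-! ### Competitors for a minimiser, and the conclusion. -/

/-- Mass-preserving dilations stay in the disc and decrease `J` below its homogeneous rescaling
when `F(a t) > a^{2_#} F(t)`. -/
theorem exists_mem_disc_J_lt {N K : ℕ} (hN : 0 < N) (hKN : K ≤ N) {s : ℝ} (hs : 0 < s) {μ ρ : ℝ}
    {f : ℝ → ℝ} (hf : Growth N s f) {u : L2 N} (hu : u ∈ disc N K s μ ρ) (hu0 : u ≠ 0) {a : ℝ}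
    (ha : 0 < a)
    (hlt : ∀ t : ℝ, t ≠ 0 → a ^ massCritical N s * primitive f t < primitive f (a * t)) :
    ∃ v ∈ disc N K s μ ρ, J N K s μ f v < a ^ (4 * s / N) * J N K s μ f u := by
  obtain ⟨hX, hinv, hmass⟩ := hu
  have hNr : (0 : ℝ) < N := by exact_mod_cast hN
  set c := a ^ (2 / (N : ℝ)) with hc
  have hc0 : 0 < c := by positivity
  have hcN : c ^ N = a ^ 2 := by
    rw [hc, ← Real.rpow_natCast, ← Real.rpow_mul ha.le, div_mul_cancel₀ _ hNr.ne', Real.rpow_two]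
  have hcs : c ^ (2 * s) = a ^ (4 * s / N) := by
    rw [hc, ← Real.rpow_mul ha.le]; congr 1; ring
  refine ⟨rescale a c hc0.ne' u, ⟨memX_rescale a hc0 hX, isInvariant_rescale hKN a hc0 hinv, ?_⟩, ?_⟩
  · rw [integral_sq_rescale a hc0, hcN, mul_inv_cancel₀ (by positivity), one_mul]
    exact hmass
  · have hi := integral_rpow_mul_primitive_lt hu0 (integrable_primitive_comp hN hs hf hX.1)
      (integrable_primitive_mul hN hs hf hX.1 a) hlt
    rw [massCritical, Real.rpow_add ha, Real.rpow_two] at hi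
    rw [J_rescale s μ f a hc0, J, hcN, hcs]
    have h1 : (a ^ 2)⁻¹ * (a ^ 2 * a ^ (4 * s / N) * ∫ x, primitive f (u x))
        < (a ^ 2)⁻¹ * ∫ x, primitive f (a * u x) := by gcongr
    have h2 : (a ^ 2)⁻¹ * (a ^ 2 * a ^ (4 * s / N) * ∫ x, primitive f (u x))
        = a ^ (4 * s / N) * ∫ x, primitive f (u x) := by field_simp
    have h3 : ∀ A : ℝ, a ^ 2 * (a ^ (4 * s / N) * (a ^ 2)⁻¹) * A = a ^ (4 * s / N) * A := by
      intro A; field_simp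
    rw [h3, mul_sub]
    linarith

/-- If `J(u) < 0` and `F(a t) > a^{2_#} F(t)` for `a < 1`, then `J` is negative at some
function of strictly smaller mass. -/
theorem exists_rescale_J_neg {N K : ℕ} (hN : 0 < N) {s : ℝ} (hs : 0 < s) {μ : ℝ}
    {f : ℝ → ℝ} (hf : Growth N s f) {u : L2 N} (hu : MemHs N s u) (hu0 : u ≠ 0)
    (hlt : ∀ a : ℝ, 0 < a → a < 1 → ∀ t : ℝ, t ≠ 0 →
      a ^ massCritical N s * primitive f t < primitive f (a * t))
    (hJ : J N K s μ f u < 0) :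
    ∃ a : ℝ, 0 < a ∧ a < 1 ∧ J N K s μ f (rescale a 1 one_ne_zero u) < 0 := by
  set A := 1 / 2 * (DsSq N s u + ∫ x : RN N, μ * (u x ^ 2 / normY N K x ^ (2 * s))) with hA
  set I := ∫ x, primitive f (u x) with hI
  -- This function of a equals J(u) < 0 at a = 1 and bounds J(a u) from above for 0 < a < 1, so
  -- values of a just below 1 work.
  have hcont : ContinuousAt (fun a : ℝ => a ^ 2 * A - a ^ massCritical N s * I) 1 := by
    refine ((continuous_pow 2).continuousAt.mul continuousAt_const).sub
      ((Real.continuousAt_rpow_const _ _ (Or.inl one_ne_zero)).mul continuousAt_const)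
  have hone : (fun a : ℝ => a ^ 2 * A - a ^ massCritical N s * I) 1 < 0 := by
    simp only [one_pow, one_mul, Real.one_rpow]
    exact hJ
  have hev := hcont.eventually (gt_mem_nhds hone)
  obtain ⟨l, hl, hlI⟩ := exists_Ioc_subset_of_mem_nhds hev ⟨0, one_pos⟩
  obtain ⟨a, ha1, ha2⟩ := exists_between (max_lt hl one_pos)
  have ha0 : 0 < a := (le_max_right _ _).trans_lt ha1
  refine ⟨a, ha0, ha2, ?_⟩
  have h1 : a ^ 2 * A - a ^ massCritical N s * I < 0 :=
    hlI ⟨(le_max_left _ _).trans_lt ha1, ha2.le⟩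
  have h2 := integral_rpow_mul_primitive_lt hu0 (integrable_primitive_comp hN hs hf hu)
      (integrable_primitive_mul hN hs hf hu a) (hlt a ha0 ha2)
  rw [J_rescale s μ f a one_pos, ← hA]
  simp only [Real.one_rpow, one_pow, inv_one, mul_one, one_mul]
  linarith

theorem rhoStar_le_of_J_neg {N K : ℕ} {s μ ρ : ℝ} {f : ℝ → ℝ} (hρ : 0 < ρ) {u : L2 N}
    (hu : u ∈ disc N K s μ ρ) (hJ : J N K s μ f u < 0) : rhoStar N K s μ f ≤ ρ := by
  have hm : m N K s μ f ρ < 0 :=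
    lt_of_le_of_lt (iInf₂_le u hu) (by exact_mod_cast hJ)
  exact iInf₂_le ρ ⟨hρ, hm⟩

end NormSol

theorem theorem1p3 (N K : ℕ) (hK : 2 ≤ K) (hKN : K ≤ N) (s : ℝ) (hs : 0 < s)
    (μ : ℝ) (hμ : NormSol.AdmissibleMu K s μ)
    (f : ℝ → ℝ) (hf : NormSol.Growth N s f)
    (hpos : 0 < NormSol.rhoStar N K s μ f) (hfin : NormSol.rhoStar N K s μ f < ⊤)
    (h : (∀ t : ℝ, t ≠ 0 → NormSol.massCritical N s * NormSol.primitive f t < f t * t) ∨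
      (∀ t : ℝ, t ≠ 0 → f t * t < NormSol.massCritical N s * NormSol.primitive f t)) :
    ¬ ∃ u ∈ NormSol.disc N K s μ (NormSol.rhoStar N K s μ f).toReal,
      u ≠ 0 ∧ IsMinOn (NormSol.J N K s μ f)
        (NormSol.disc N K s μ (NormSol.rhoStar N K s μ f).toReal) u := by
  open NormSol in
  rintro ⟨u, hu, hu0, hmin⟩
  have hN : 0 < N := by omega
  have hNr : (0 : ℝ) < N := by exact_mod_cast hN
  obtain ⟨ρ, hρ⟩ : ∃ ρ : ℝ, rhoStar N K s μ f = ρ :=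
    ⟨_, (EReal.coe_toReal hfin.ne hpos.bot_lt.ne').symm⟩
  have hρ0 : 0 < ρ := by rw [hρ] at hpos; exact_mod_cast hpos
  rw [hρ, EReal.toReal_coe] at hu hmin
  -- The zero function is the rescaling of u with amplitude 0, so it inherits membership from u.
  have hzero : (0 : L2 N) ∈ disc N K s μ ρ := by
    rw [← rescale_zero_left one_ne_zero u]
    refine ⟨memX_rescale 0 one_pos hu.1, isInvariant_rescale hKN 0 one_pos hu.2.1, ?_⟩
    rw [integral_sq_rescale 0 one_pos]
    simpa using hρ0.le
  have hJ0 : J N K s μ f u ≤ 0 := by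
    have h1 : J N K s μ f u ≤ J N K s μ f 0 := hmin hzero
    rwa [J_zero] at h1
  rcases h with h | h
  · obtain ⟨v, hv, hlt⟩ := exists_mem_disc_J_lt hN hKN hs hf hu hu0 (a := 2) two_pos fun t ht =>
      rpow_mul_primitive_lt_of_one_lt hf.continuous h ht one_lt_two
    have h1 : J N K s μ f u ≤ J N K s μ f v := hmin hv
    -- As J(u) ≤ 0, a factor at least 1 cannot raise it, whence J(v) < J(u).
    have h2 : (1 : ℝ) ≤ 2 ^ (4 * s / N) := Real.one_le_rpow one_le_two (by positivity)
    nlinarith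
  · have hlt : ∀ a : ℝ, 0 < a → a < 1 → ∀ t : ℝ, t ≠ 0 →
        a ^ massCritical N s * primitive f t < primitive f (a * t) := fun a ha0 ha1 t ht =>
      rpow_mul_primitive_lt_of_lt_one hf.continuous h ht ha0 ha1
    rcases hJ0.lt_or_eq with hneg | hJ
    · obtain ⟨a, ha0, ha1, hJa⟩ := exists_rescale_J_neg hN hs hf hu.1.1 hu0 hlt hneg
      -- The function a u has mass at most a²ρ < ρ = ρ_* and negative energy, against the definition
      -- of ρ_* as an infimum.
      have hle : rhoStar N K s μ f ≤ (a ^ 2 * ρ : ℝ) := by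
        refine rhoStar_le_of_J_neg (by positivity)
          ⟨memX_rescale a one_pos hu.1, isInvariant_rescale hKN a one_pos hu.2.1, ?_⟩ hJa
        rw [integral_sq_rescale a one_pos, one_pow, inv_one, mul_one]
        exact mul_le_mul_of_nonneg_left hu.2.2 (sq_nonneg a)
      rw [hρ, EReal.coe_le_coe_iff] at hle
      have : a ^ 2 < 1 := pow_lt_one₀ ha0.le ha1 two_ne_zero
      nlinarith
    · obtain ⟨v, hv, hlt'⟩ := exists_mem_disc_J_lt hN hKN hs hf hu hu0 (a := 1 / 2) (by norm_num)
        (hlt _ (by norm_num) (by norm_num))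
      have h1 : J N K s μ f u ≤ J N K s μ f v := hmin hv
      rw [hJ, mul_zero] at hlt'
      linarith
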